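/- Setting. Two players $i\in\{1,2\}$ have nonempty finite action sets $\mathcal A_1,\mathcal A_2$; $A=\max_i|\mathcal A_i|$; utilities $u_i:\mathcal A_1\times\mathcal A_2\to[0,1]$ with $u_1+u_2$ constant (a zero-sum game with payoffs normalized to $[0,1]$). Let $\Delta,\varepsilon\in(0,1]$, $\delta\in(0,1)$, $N=2$. *Rationalizability.* Let $E_0=\emptyset$ and let $E_{l}$ be the set of actions $a\in\mathcal A_i$, $i\in\{1,2\}$, for which some mixed strategy $x$ of player $i$ satisfies $u_i(a,b)\le u_i(x,b)-\Delta$ for all opponent actions $b\notin E_{l-1}$. Let $L=\min\{l\ge1: E_{l+1}=E_l\}$. Actions outside $E_L$ are called $\Delta$-rationalizable. A mixed profile $(x_1,x_2)$ is an $\varepsilon$-Nash equilibrium if $u_i(x_1,x_2)\ge u_i(a,x_{-i})-\varepsilon$ for all $i$ and $a\in\mathcal A_i$; it is $\Delta$-rationalizable if it plays only $\Delta$-rationalizable actions. *Bandit feedback.* One sample is one play of an action profile $a$, after which each player $i$ observes a random $U_i\in[0,1]$ with conditional mean $u_i(a)$ given the past and $a$. *CCE Hedge algorithm with accuracy $\varepsilon'$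 and $T$ Hedge rounds.* 1. Start at any profile $a^{(0)}$. For $l=1,\dots,L$, for each player $i$ and each $a\in\mathcal A_i$, play $(a,a^{(l-1)}_{-i})$ for $\lceil 64\ln(ANL/\delta)/\Delta^2\rceil$ times, and let $a^{(l)}_i$ maximize the average payoff observed by player $i$ (any fixed measurable tie-breaking rule). Let $\theta^{(1)}_i$ be the point mass at $a^{(L)}_i$. 2. For $t=1,\dots,T$, for each $i$ and each $a\in\mathcal A_i$, play $(a,\theta^{(t)}_{-i})$ for $M_t=\lceil 64\ln(ANT/\delta)/(\Delta^2t)\rceil$ times, with average payoff $u^{(t)}_i(a)$ of player $i$; set $\theta^{(t+1)}_i(\cdot)\propto\exp\bigl(\eta_t\sum_{\tau\le t}u_i^{(\tau)}(\cdot)\bigr)$, where $\eta_t=\max\{\sqrt{\ln A/t},\,4\ln(1/p)/(\Delta t)\}$ and $p=\min\{\varepsilon',\Delta\}/(8AN)$. 3. In each $\theta^{(t)}_i$, $t\le T$, remove the actions of probability smaller than $p$ and renormalize to get $\bar\theta^{(t)}_i$. Output $\Pi=\frac1T\sum_{t=1}^T\bar\theta_1^{(t)}\otimes\bar\theta_2^{(t)}$.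 **Corollary.** There are absolute constants $C>0$, $k\in\mathbb N$ and a choice of the number of rounds $T=T(A,\Delta,\varepsilon,\delta)$ with $$T\le C\Bigl(\frac1{\varepsilon^2}+\frac1{\varepsilon\Delta}\Bigr)\ln^k\frac{2A}{\Delta\varepsilon\delta}$$ such that for every two-player zero-sum game and all $\Delta,\varepsilon,\delta$ as above, the CCE Hedge algorithm, run with accuracy $\varepsilon'=\varepsilon/2$, uses in total at most $$C\Bigl(\frac{LA}{\Delta^2}+\frac{A}{\varepsilon^2}\Bigr)\ln^k\frac{2AL}{\Delta\varepsilon\delta}=\tilde O\Bigl(\frac{LA}{\Delta^2}+\frac A{\varepsilon^2}\Bigr)$$ samples, and with probability at least $1-3\delta$ the pair of marginal distributions of its output $\Pi$ is a $\Delta$-rationalizable $\varepsilon$-Nash equilibrium. -/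

import Mathlib

open MeasureTheory ProbabilityTheory

/-- Pure action profiles of the game in which player `j` has the actions `0, …, A j - 1`. -/
abbrev Profile {N : ℕ} (A : Fin N → ℕ) : Type := ∀ j, Fin (A j)

/-- One vector over the own action set for every player (a mixed strategy profile when each vector
lies in the standard simplex; also used for vectors of payoffs). -/
abbrev PlayerVec {N : ℕ} (A : Fin N → ℕ) : Type := ∀ j, Fin (A j) → ℝ

/-- The largest number of actions of a player. -/
def maxActions {N : ℕ} (A : Fin N → ℕ) : ℕ := Finset.univ.sup A

/-- An `N`-player normal-form game with utilities in `[0, 1]`. -/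
structure Game {N : ℕ} (A : Fin N → ℕ) where
  u : Fin N → Profile A → ℝ
  u_mem : ∀ i a, u i a ∈ Set.Icc (0 : ℝ) 1

/-- The mixed strategy that plays the action `a` with probability one. -/
def pureStrat {n : ℕ} (a : Fin n) : Fin n → ℝ := Pi.single a 1

/-- The product weights of a mixed strategy profile. -/
def prodDist {N : ℕ} {A : Fin N → ℕ} (x : PlayerVec A) (a : Profile A) : ℝ := ∏ j, x j (a j)

/-- The marginal for player `i` of weights on action profiles. -/
noncomputable def marginal {N : ℕ} {A : Fin N → ℕ} (Q : Profile A → ℝ) : PlayerVec A :=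
  fun i a => ∑ b : Profile A, if b i = a then Q b else 0

namespace Game

variable {N : ℕ} {A : Fin N → ℕ}

/-- Expected utility of player `i` under a correlated strategy. -/
noncomputable def payoff (G : Game A) (i : Fin N) (Q : Profile A → ℝ) : ℝ :=
  ∑ a : Profile A, Q a * G.u i a

/-- `x` is an `ε`-Nash equilibrium in mixed strategies. -/
def IsNash (G : Game A) (ε : ℝ) (x : PlayerVec A) : Prop :=
  (∀ i, x i ∈ stdSimplex ℝ (Fin (A i))) ∧
    ∀ (i : Fin N) (a : Fin (A i)),
      G.payoff i (prodDist (Function.update x i (pureStrat a))) - ε ≤ G.payoff i (prodDist x)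

/-- The actions of each player that some mixed strategy beats by at least `Δ` against every profile
of the other players that avoids `E`. (The entry `b i` of `b` is overwritten, hence irrelevant.) -/
def dominatedGiven (G : Game A) (Δ : ℝ) (E : ∀ j, Set (Fin (A j))) (i : Fin N) :
    Set (Fin (A i)) :=
  {a | ∃ x ∈ stdSimplex ℝ (Fin (A i)), ∀ b : Profile A, (∀ j, j ≠ i → b j ∉ E j) →
    G.u i (Function.update b i a) ≤ (∑ c, x c * G.u i (Function.update b i c)) - Δ}

/-- The actions eliminated within `l` rounds of iterated `Δ`-dominance elimination. -/
def elim (G : Game A) (Δ : ℝ) : ℕ → ∀ i, Set (Fin (A i))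
  | 0 => fun _ => ∅
  | l + 1 => G.dominatedGiven Δ (G.elim Δ l)

/-- The minimum elimination length: the least `l ≥ 1` with `E_{l+1} = E_l`. -/
noncomputable def elimLength (G : Game A) (Δ : ℝ) : ℕ :=
  sInf {l | 1 ≤ l ∧ G.elim Δ (l + 1) = G.elim Δ l}

/-- `a` is a `Δ`-rationalizable action of player `i`. -/
def IsRationalizable (G : Game A) (Δ : ℝ) (i : Fin N) (a : Fin (A i)) : Prop :=
  a ∉ G.elim Δ (G.elimLength Δ) i

/-- The strategy profile `x` plays only `Δ`-rationalizable actions. -/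
def PlaysRationalizable (G : Game A) (Δ : ℝ) (x : PlayerVec A) : Prop :=
  ∀ i a, x i a ≠ 0 → G.IsRationalizable Δ i a

/-- Two-player zero-sum game. Since utilities are normalized to `[0, 1]`, the two utilities sum to
a constant, which is zero after a shift of the payoffs. -/
def IsZeroSum {A : Fin 2 → ℕ} (G : Game A) : Prop :=
  ∃ c : ℝ, ∀ a, G.u 0 a + G.u 1 a = c

end Game

/-! ### Bandit interaction in rounds

In each round the players take turns to enumerate their actions: for every player `i` and every
action `a` of `i`, the profile `(a, x_{-i})` is played a number of times, where `x` is the mixed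
strategy profile of the round, a function of the observations of the earlier rounds. -/

/-- The single plays (samples) in `R` rounds: in round `r`, player `i` tries out action `a` for the
`m`-th time, `m < batch r`. -/
abbrev Slot {N : ℕ} (A : Fin N → ℕ) (R : ℕ) (batch : ℕ → ℕ) : Type :=
  (r : Fin R) × (i : Fin N) × Fin (A i) × Fin (batch r)

namespace Slot

variable {N : ℕ} {A : Fin N → ℕ} {R : ℕ} {batch : ℕ → ℕ}

/-- Plays take place in the lexicographic order of (round, player, action, repetition). -/
def time (s : Slot A R batch) : ℕ ×ₗ ℕ ×ₗ ℕ ×ₗ ℕ :=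
  toLex ((s.1 : ℕ), toLex ((s.2.1 : ℕ), toLex ((s.2.2.1 : ℕ), (s.2.2.2 : ℕ))))

end Slot

/-- The average payoff that player `i` observed for action `a` in round `r`. -/
noncomputable def avgPayoff {N : ℕ} {A : Fin N → ℕ} {R : ℕ} {batch : ℕ → ℕ} {Ω : Type*}
    (fb : Slot A R batch → Ω → Fin N → ℝ) (ω : Ω) (r : ℕ) : PlayerVec A :=
  fun i a =>
    if h : r < R then (∑ m : Fin (batch r), fb ⟨⟨r, h⟩, i, a, m⟩ ω i) / (batch r : ℝ) else 0

/-- What has been observed (profiles played and feedback received) before play `s`. -/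
abbrev pastInfo {N : ℕ} {A : Fin N → ℕ} {R : ℕ} {batch : ℕ → ℕ} {Ω : Type*}
    (act : Slot A R batch → Ω → Profile A) (fb : Slot A R batch → Ω → Fin N → ℝ)
    (s : Slot A R batch) : MeasurableSpace Ω :=
  ⨆ (s' : Slot A R batch) (_ : s'.time < s.time),
    MeasurableSpace.comap (fun ω => (act s' ω, fb s' ω)) inferInstance

/-- The random profiles `act` and feedback `fb` arise when game `G` is played under bandit feedback
and the mixed strategy profile of round `r` is `strat w r`, with `w` the sequence of observed
average payoffs. Given the past, in the play where player `i` tries out `a`, player `i` plays `a` and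
the others play independently from their strategies; given the past and the profile played, the
feedback of each player lies in `[0, 1]` and has the player's utility as its mean. -/
structure IsBanditRun {N : ℕ} {A : Fin N → ℕ} (G : Game A) (R : ℕ) (batch : ℕ → ℕ)
    (strat : (ℕ → PlayerVec A) → ℕ → PlayerVec A)
    {Ω : Type*} [MeasurableSpace Ω] (P : Measure Ω)
    (act : Slot A R batch → Ω → Profile A) (fb : Slot A R batch → Ω → Fin N → ℝ) : Prop where
  measurable_act : ∀ s, Measurable (act s)
  measurable_fb : ∀ s, Measurable (fb s)
  fb_mem : ∀ s ω j, fb s ω j ∈ Set.Icc (0 : ℝ) 1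
  act_law : ∀ (s : Slot A R batch) (b : Profile A),
    P[Set.indicator {ω | act s ω = b} (fun _ => (1 : ℝ)) | pastInfo act fb s] =ᵐ[P]
      fun ω => prodDist
        (Function.update (strat (avgPayoff fb ω) s.1) s.2.1 (pureStrat s.2.2.1)) b
  fb_mean : ∀ (s : Slot A R batch) (j : Fin N),
    P[fun ω => fb s ω j | pastInfo act fb s ⊔ MeasurableSpace.comap (act s) inferInstance] =ᵐ[P]
      fun ω => G.u j (act s ω)

/-! ### The CCE Hedge algorithm

Rounds `0, …, L - 1` are the rounds of the subroutine that finds a rationalizable action profile by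
iterated empirical best responses; round `L + t` is the `(t + 1)`-st round of Hedge. -/

/-- A measurable rule that selects, for each player, an action with the largest payoff. -/
structure IsArgmaxRule {N : ℕ} {A : Fin N → ℕ} (sel : ∀ i, (Fin (A i) → ℝ) → Fin (A i)) :
    Prop where
  measurable_sel : ∀ i, Measurable (sel i)
  le_sel : ∀ i (v : Fin (A i) → ℝ) (a : Fin (A i)), v a ≤ v (sel i v)

/-- Iterated empirical best responses from the initial profile `a₀`. -/
def bestResponses {N : ℕ} {A : Fin N → ℕ} (sel : ∀ i, (Fin (A i) → ℝ) → Fin (A i))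
    (a₀ : Profile A) (w : ℕ → PlayerVec A) : ℕ → Profile A
  | 0 => a₀
  | l + 1 => fun i => sel i (w l i)

/-- Exponential weights. -/
noncomputable def softmax {n : ℕ} (v : Fin n → ℝ) : Fin n → ℝ :=
  fun a => Real.exp (v a) / ∑ b, Real.exp (v b)

/-- The Hedge iterates: `hedge η a w t` is the strategy profile of the `(t + 1)`-st round. -/
noncomputable def hedge {N : ℕ} {A : Fin N → ℕ} (η : ℕ → ℝ) (a : Profile A)
    (w : ℕ → PlayerVec A) : ℕ → PlayerVec A
  | 0 => fun i => pureStrat (a i)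
  | t + 1 => fun i => softmax fun c => η (t + 1) * ∑ τ ∈ Finset.range (t + 1), w τ i c

/-- Remove the actions of probability smaller than `p` and renormalize. -/
noncomputable def clip {n : ℕ} (p : ℝ) (x : Fin n → ℝ) : Fin n → ℝ :=
  fun a => (if x a < p then 0 else x a) / ∑ b, (if x b < p then 0 else x b)

namespace CCEHedge

/-- Clipping threshold. -/
noncomputable def threshold {N : ℕ} (A : Fin N → ℕ) (Δ ε : ℝ) : ℝ :=
  min ε Δ / (8 * maxActions A * N)

/-- Learning rate `η_t`, `t ≥ 1`. -/
noncomputable def rate {N : ℕ} (A : Fin N → ℕ) (Δ ε : ℝ) (t : ℕ) : ℝ :=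
  max (Real.sqrt (Real.log (maxActions A) / t)) (4 * Real.log (1 / threshold A Δ ε) / (Δ * t))

/-- Number of repetitions of each play in round `r`. -/
noncomputable def batch {N : ℕ} (A : Fin N → ℕ) (L T : ℕ) (Δ δ : ℝ) (r : ℕ) : ℕ :=
  if r < L then ⌈64 * Real.log (maxActions A * N * L / δ) / Δ ^ 2⌉₊
  else ⌈64 * Real.log (maxActions A * N * T / δ) / (Δ ^ 2 * ((r - L + 1 : ℕ) : ℝ))⌉₊

variable {N : ℕ} {A : Fin N → ℕ}

/-- The Hedge iterates `θ^(t+1)` after the `L` best-response rounds. -/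
noncomputable def iterate (L : ℕ) (Δ ε : ℝ) (sel : ∀ i, (Fin (A i) → ℝ) → Fin (A i))
    (a₀ : Profile A) (w : ℕ → PlayerVec A) (t : ℕ) : PlayerVec A :=
  hedge (rate A Δ ε) (bestResponses sel a₀ w L) (fun τ => w (L + τ)) t

/-- The mixed strategy profile of round `r`. -/
noncomputable def strat (L : ℕ) (Δ ε : ℝ) (sel : ∀ i, (Fin (A i) → ℝ) → Fin (A i))
    (a₀ : Profile A) (w : ℕ → PlayerVec A) (r : ℕ) : PlayerVec A :=
  if r < L then fun i => pureStrat (bestResponses sel a₀ w r i)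
  else iterate L Δ ε sel a₀ w (r - L)

/-- The correlated strategy that the algorithm outputs. -/
noncomputable def output (L T : ℕ) (Δ ε : ℝ) (sel : ∀ i, (Fin (A i) → ℝ) → Fin (A i))
    (a₀ : Profile A) (w : ℕ → PlayerVec A) (b : Profile A) : ℝ :=
  (∑ t ∈ Finset.range T,
    prodDist (fun i => clip (threshold A Δ ε) (iterate L Δ ε sel a₀ w t i)) b) / T

/-- `act` and `fb` are the profiles played and the feedback received in an execution of the
algorithm on `G` with parameters `Δ`, `ε`, `δ` and `T` Hedge rounds. -/
def IsRun (G : Game A) (T : ℕ) (Δ ε δ : ℝ) (sel : ∀ i, (Fin (A i) → ℝ) → Fin (A i))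
    (a₀ : Profile A) {Ω : Type*} [MeasurableSpace Ω] (P : Measure Ω)
    (act : Slot A (G.elimLength Δ + T) (batch A (G.elimLength Δ) T Δ δ) → Ω → Profile A)
    (fb : Slot A (G.elimLength Δ + T) (batch A (G.elimLength Δ) T Δ δ) → Ω → Fin N → ℝ) : Prop :=
  IsBanditRun G (G.elimLength Δ + T) (batch A (G.elimLength Δ) T Δ δ)
    (strat (G.elimLength Δ) Δ ε sel a₀) P act fb

/-- The total number of plays in an execution of the algorithm. -/
noncomputable def numSamples (G : Game A) (T : ℕ) (Δ δ : ℝ) : ℕ :=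
  Fintype.card (Slot A (G.elimLength Δ + T) (batch A (G.elimLength Δ) T Δ δ))

end CCEHedge

/-! All randomness enters through scalar sums of (observed payoff minus true mean), weighted by
coefficients known before the round. An Azuma inequality for predictable weights
(`measure_le_sum_weighted`, transferred to batches in `measure_le_sum_deviation_single`) controls
three families of such sums, each failing with probability at most `δ`. The rest is deterministic.

Best responses: an action of `E_{l+1}` loses at least `Δ` in mean to some mixed strategy as long as
the opponent avoids `E_l`. With noise below `Δ / 2` it cannot be an empirical maximizer, so after
`L` rounds the profile avoids `E_L` (`bestResponses_notMem_elim`).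

Hedge never leaves the rationalizable region (`iterate_lt_threshold`): if all earlier iterates give
each action of `E_L` less than the threshold `p`, such an action, dominated given `E_{L+1} = E_L`,
trails its dominating strategy by `3Δ/4` per round in mean and by `Δ/2` per round as observed. The
rate is at least `4 log(1/p) / (Δ t)`, so its weight is at most `p ^ 2 < p`, and clipping removes
it. The permitted noise `tΔ/4` grows linearly in `t`, which is why batches proportional to `1/t`
suffice and their total is only logarithmic in `T`, up to rounding.

Equilibrium: the raised rate adds only a term of order `log^2 / Δ` to the usual regret of order `√(T
log)`, so `T` of order `1/ε^2 + 1/(εΔ)`, up to logarithms, gives average regret at most `2ε/5`. In a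
zero-sum game with small regrets the averaged strategies are nearly Nash
(`IsZeroSum.isNash_average`), and clipping costs little. The cross term `1/(εΔ)` is absorbed by
`1/ε^2 + 1/Δ^2` in the sample count. -/

/-! ### Concentration of weighted sums of bounded observations -/

/-- Hoeffding's lemma for a Bernoulli variable. -/
theorem bernoulli_mgf_le {m : ℝ} (h0 : 0 ≤ m) (h1 : m ≤ 1) (y : ℝ) :
    1 - m + m * Real.exp y ≤ Real.exp (m * y + y ^ 2 / 8) := by
  have hint : ∀ f : ℝ → ℝ, Measurable f →
      ∫ x, f x ∂(ENNReal.ofReal (1 - m) • Measure.dirac (0 : ℝ)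
        + ENNReal.ofReal m • Measure.dirac (1 : ℝ)) = (1 - m) * f 0 + m * f 1 := by
    intro f hf
    have hi : ∀ (a : ℝ), Integrable f (Measure.dirac a) := fun a =>
      (integrable_dirac (by simp)) 
    rw [integral_add_measure ((hi 0).smul_measure (by simp)) ((hi 1).smul_measure (by simp)),
      integral_smul_measure, integral_smul_measure, integral_dirac, integral_dirac,
      ENNReal.toReal_ofReal h0, ENNReal.toReal_ofReal (by linarith)]
    simp
  set μ : Measure ℝ := ENNReal.ofReal (1 - m) • Measure.dirac (0 : ℝ)
        + ENNReal.ofReal m • Measure.dirac (1 : ℝ) with hμ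
  have : IsProbabilityMeasure μ := ⟨by
    simp [hμ]
    rw [← ENNReal.ofReal_add (by linarith) h0]
    simp⟩
  have hb : ∀ᵐ x ∂μ, x ∈ Set.Icc (0 : ℝ) 1 := by
    rw [hμ, ae_add_measure_iff]
    exact ⟨Measure.ae_smul_measure ((ae_dirac_iff measurableSet_Icc).2 (by simp)) _,
      Measure.ae_smul_measure ((ae_dirac_iff measurableSet_Icc).2 (by simp)) _⟩
  -- The two-point law lives on an interval of length one, so its variance proxy is `(1/2)^2`, which
  -- gives `y^2/8`.
  have h := (hasSubgaussianMGF_of_mem_Icc (X := fun x : ℝ => x) (μ := μ) aemeasurable_id hb).mgf_le y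
  rw [mgf, hint _ (by fun_prop), hint _ (by fun_prop)] at h
  have e1 : m * y + y ^ 2 / 8 = m * y + ((((‖(1 : ℝ) - 0‖₊ / 2) ^ 2 : NNReal) : ℝ) * y ^ 2 / 2) := by
    simp; ring
  rw [e1, Real.exp_add]
  refine le_trans (le_of_eq ?_) (mul_le_mul_of_nonneg_left h (Real.exp_pos _).le)
  have e2 : Real.exp (m * y) * Real.exp (y * (0 - ((1 - m) * 0 + m * 1))) = 1 := by
    rw [← Real.exp_add, Real.exp_eq_one_iff]; ring
  have e3 : Real.exp (m * y) * Real.exp (y * (1 - ((1 - m) * 0 + m * 1))) = Real.exp y := by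
    rw [← Real.exp_add]; ring_nf
  rw [mul_add, mul_left_comm, e2, mul_left_comm, e3]; ring

/-- The exponential lies below its chord over `[0, 1]`. -/
theorem exp_mul_le_chord {x : ℝ} (h0 : 0 ≤ x) (h1 : x ≤ 1) (y : ℝ) :
    Real.exp (y * x) ≤ 1 - x + x * Real.exp y := by
  have h := convexOn_exp.2 (Set.mem_univ 0) (Set.mem_univ y) (sub_nonneg.2 h1) h0 (by ring)
  simpa [mul_comm x y] using h

/-- Hoeffding's lemma for a finite distribution. -/
theorem sum_mul_exp_le {ι : Type*} [Fintype ι] {x v : ι → ℝ} (hx : x ∈ stdSimplex ℝ ι)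
    (hv : ∀ i, v i ∈ Set.Icc (0 : ℝ) 1) (y : ℝ) :
    ∑ i, x i * Real.exp (y * v i) ≤ Real.exp (y * ∑ i, x i * v i + y ^ 2 / 8) := by
  have hm0 : 0 ≤ ∑ i, x i * v i :=
    Finset.sum_nonneg fun i _ => mul_nonneg (hx.1 i) (hv i).1
  have hm1 : ∑ i, x i * v i ≤ 1 := by
    rw [← hx.2]
    exact Finset.sum_le_sum fun i _ => mul_le_of_le_one_right (hx.1 i) (hv i).2
  calc ∑ i, x i * Real.exp (y * v i)
      ≤ ∑ i, x i * (1 - v i + v i * Real.exp y) := Finset.sum_le_sum fun i _ =>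
        mul_le_mul_of_nonneg_left (exp_mul_le_chord (hv i).1 (hv i).2 y) (hx.1 i)
    _ = 1 - ∑ i, x i * v i + (∑ i, x i * v i) * Real.exp y := by
        have : ∀ i, x i * (1 - v i + v i * Real.exp y)
            = x i - x i * v i + x i * v i * Real.exp y := fun i => by ring
        simp_rw [this]
        rw [Finset.sum_add_distrib, Finset.sum_sub_distrib, hx.2, Finset.sum_mul]
    _ ≤ _ := by
        have := bernoulli_mgf_le hm0 hm1 y
        rwa [mul_comm y (∑ i, x i * v i)]

section Azuma

variable {Ω : Type*} {m0 : MeasurableSpace Ω} {P : Measure Ω}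

theorem integrable_of_measurable_of_bound [IsFiniteMeasure P] {f : Ω → ℝ} (hf : Measurable f)
    {c : ℝ} (hc : ∀ ω, |f ω| ≤ c) : Integrable f P :=
  Integrable.of_bound hf.aestronglyMeasurable c (Filter.Eventually.of_forall hc)

/-- A bounded `F`-measurable factor does not distinguish a variable from its conditional mean. -/
theorem integral_mul_eq_of_condExp [IsProbabilityMeasure P] {F : MeasurableSpace Ω} (hF : F ≤ m0)
    {X m B : Ω → ℝ} (hX : Integrable X P) (hm : P[X|F] =ᵐ[P] m) (hB : Measurable[F] B) {c : ℝ}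
    (hc : ∀ ω, |B ω| ≤ c) : ∫ ω, B ω * X ω ∂P = ∫ ω, B ω * m ω ∂P := by
  have h1 := condExp_stronglyMeasurable_mul_of_bound hF (μ := P) hB.stronglyMeasurable hX c
    (Filter.Eventually.of_forall hc)
  calc ∫ ω, B ω * X ω ∂P = ∫ ω, (P[B * X|F]) ω ∂P := (integral_condExp hF).symm
    _ = ∫ ω, B ω * m ω ∂P := by
      refine integral_congr_ae ?_
      filter_upwards [h1, hm] with ω h1 h2
      rw [h1, Pi.mul_apply, h2]

variable {ι τ : Type*} [LinearOrder τ]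

/-- The exponential supermartingale of a weighted sum with predictable weights. -/
theorem integral_prod_exp_le_one [IsProbabilityMeasure P] (time : ι → τ)
    (htime : Function.Injective time) {F : ι → MeasurableSpace Ω} (hF : ∀ s, F s ≤ m0)
    (hmono : ∀ s' s, time s' < time s → F s' ≤ F s) {X m w : ι → Ω → ℝ}
    (hXmeas : ∀ s, Measurable (X s)) (hX : ∀ s ω, X s ω ∈ Set.Icc (0 : ℝ) 1)
    (hXF : ∀ s' s, time s' < time s → Measurable[F s] (X s'))
    (hmF : ∀ s, Measurable[F s] (m s)) (hm : ∀ s ω, m s ω ∈ Set.Icc (0 : ℝ) 1)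
    (hcond : ∀ s, P[X s|F s] =ᵐ[P] m s) (hwF : ∀ s, Measurable[F s] (w s)) {K : ℝ}
    (hK : ∀ s ω, |w s ω| ≤ K) (l : ℝ) (S : Finset ι) :
    ∫ ω, ∏ s ∈ S, Real.exp (l * w s ω * (X s ω - m s ω) - (l * w s ω) ^ 2 / 8) ∂P ≤ 1 := by
  classical
  set g : ι → Ω → ℝ := fun s ω =>
    Real.exp (l * w s ω * (X s ω - m s ω) - (l * w s ω) ^ 2 / 8) with hg
  have hwb : ∀ s ω, |l * w s ω| ≤ |l| * K := fun s ω => by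
    rw [abs_mul]; exact mul_le_mul_of_nonneg_left (hK s ω) (abs_nonneg _)
  have hgle : ∀ s ω, g s ω ≤ Real.exp (|l| * K) := fun s ω => by
    refine Real.exp_le_exp.2 ?_
    have h1 : |l * w s ω * (X s ω - m s ω)| ≤ |l| * K * 1 := by
      rw [abs_mul]
      refine mul_le_mul (hwb s ω) ?_ (abs_nonneg _) ((abs_nonneg _).trans (hwb s ω))
      rw [abs_le]
      constructor <;> linarith [(hX s ω).1, (hX s ω).2, (hm s ω).1, (hm s ω).2]
    linarith [(abs_le.1 h1).2, sq_nonneg (l * w s ω)]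
  have hgmeas : ∀ s, Measurable (g s) := fun s => by
    have h1 := (hwF s).mono (hF s) le_rfl
    have h2 := (hmF s).mono (hF s) le_rfl
    have h3 := hXmeas s
    exact Real.measurable_exp.comp
      (((h1.const_mul l).mul (h3.sub h2)).sub (((h1.const_mul l).pow_const 2).div_const 8))
  induction S using Finset.induction_on_max_value time with
  | empty => simp
  | insert a S ha hmax ih =>
    -- The latest observation is peeled off last: every other factor is then measurable with respect
    -- to `F a` and can be treated as a constant.
    have hlt : ∀ s ∈ S, time s < time a := fun s hs =>
      lt_of_le_of_ne (hmax s hs) fun h => ha (htime h ▸ hs)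
    set H : Ω → ℝ := fun ω => ∏ s ∈ S, g s ω with hH
    have hHF : Measurable[F a] H := by
      refine Finset.measurable_fun_prod S fun s hs => ?_
      have h1 := (hwF s).mono (hmono s a (hlt s hs)) le_rfl
      have h2 := (hmF s).mono (hmono s a (hlt s hs)) le_rfl
      have h3 := hXF s a (hlt s hs)
      exact Real.measurable_exp.comp
        (((h1.const_mul l).mul (h3.sub h2)).sub (((h1.const_mul l).pow_const 2).div_const 8))
    have hH0 : ∀ ω, 0 ≤ H ω := fun ω => Finset.prod_nonneg fun s _ => (Real.exp_pos _).le
    have hHle : ∀ ω, H ω ≤ Real.exp (|l| * K) ^ S.card := fun ω => by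
      rw [← Finset.prod_const]
      exact Finset.prod_le_prod (fun s _ => (Real.exp_pos _).le) fun s _ => hgle s ω
    set D := Real.exp (|l| * K) ^ S.card with hD
    have hD0 : 0 ≤ D := by positivity
    set c : Ω → ℝ := fun ω => Real.exp (-(l * w a ω * m a ω) - (l * w a ω) ^ 2 / 8) with hc
    have hc0 : ∀ ω, 0 < c ω := fun ω => Real.exp_pos _
    have hcle : ∀ ω, c ω ≤ Real.exp (|l| * K) := fun ω => by
      refine Real.exp_le_exp.2 ?_
      have h1 : |l * w a ω * m a ω| ≤ |l| * K * 1 := by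
        rw [abs_mul]
        refine mul_le_mul (hwb a ω) ?_ (abs_nonneg _) ((abs_nonneg _).trans (hwb a ω))
        rw [abs_of_nonneg (hm a ω).1]; exact (hm a ω).2
      linarith [(abs_le.1 h1).1, sq_nonneg (l * w a ω)]
    have hcF : Measurable[F a] c := Real.measurable_exp.comp
      ((((hwF a).const_mul l).mul (hmF a)).neg.sub ((((hwF a).const_mul l).pow_const 2).div_const 8))
    set B : Ω → ℝ := fun ω => H ω * c ω with hB
    have hBF : Measurable[F a] B := hHF.mul hcF
    have hB0 : ∀ ω, 0 ≤ B ω := fun ω => mul_nonneg (hH0 ω) (hc0 ω).le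
    have hBle : ∀ ω, |B ω| ≤ D * Real.exp (|l| * K) := fun ω => by
      rw [abs_of_nonneg (hB0 ω)]
      exact mul_le_mul (hHle ω) (hcle ω) (hc0 ω).le hD0
    -- Replacing the exponential in `X a` by its chord makes the integrand `B + B' * X a`, affine in
    -- `X a` with `F a`-measurable coefficients. Only the conditional mean then matters, and the
    -- Bernoulli bound closes the step.
    set B' : Ω → ℝ := fun ω => B ω * (Real.exp (l * w a ω) - 1) with hB'
    have hB'F : Measurable[F a] B' :=
      hBF.mul ((Real.measurable_exp.comp ((hwF a).const_mul l)).sub_const 1)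
    have hB'le : ∀ ω, |B' ω| ≤ D * Real.exp (|l| * K) * (Real.exp (|l| * K) + 1) := fun ω => by
      rw [abs_mul]
      refine mul_le_mul (hBle ω) ?_ (abs_nonneg _) ((abs_nonneg _).trans (hBle ω))
      have h1 : Real.exp (l * w a ω) ≤ Real.exp (|l| * K) :=
        Real.exp_le_exp.2 ((le_abs_self _).trans (hwb a ω))
      have h2 := Real.exp_pos (l * w a ω)
      rw [abs_le]; constructor <;> linarith
    have hBint : Integrable B P := integrable_of_measurable_of_bound (hBF.mono (hF a) le_rfl) hBle
    have hXint : Integrable (X a) P := integrable_of_measurable_of_bound (hXmeas a) (c := 1)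
      fun ω => by rw [abs_of_nonneg (hX a ω).1]; exact (hX a ω).2
    have hB'meas := hB'F.mono (hF a) le_rfl
    have hB'X : Integrable (fun ω => B' ω * X a ω) P :=
      integrable_of_measurable_of_bound (hB'meas.mul (hXmeas a)) fun ω => by
        rw [abs_mul]
        refine (mul_le_of_le_one_right (abs_nonneg _) ?_).trans (hB'le ω)
        rw [abs_of_nonneg (hX a ω).1]; exact (hX a ω).2
    have hB'm : Integrable (fun ω => B' ω * m a ω) P :=
      integrable_of_measurable_of_bound (hB'meas.mul ((hmF a).mono (hF a) le_rfl)) fun ω => by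
        rw [abs_mul]
        refine (mul_le_of_le_one_right (abs_nonneg _) ?_).trans (hB'le ω)
        rw [abs_of_nonneg (hm a ω).1]; exact (hm a ω).2
    have hHint : Integrable H P := integrable_of_measurable_of_bound (hHF.mono (hF a) le_rfl)
      (c := D) fun ω => by rw [abs_of_nonneg (hH0 ω)]; exact hHle ω
    simp_rw [Finset.prod_insert ha]
    calc ∫ ω, g a ω * H ω ∂P ≤ ∫ ω, (B ω + B' ω * X a ω) ∂P := by
          refine integral_mono_of_nonneg
            (Filter.Eventually.of_forall fun ω => mul_nonneg (Real.exp_pos _).le (hH0 ω))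
            (hBint.add hB'X) (Filter.Eventually.of_forall fun ω => ?_)
          have h1 : g a ω = c ω * Real.exp (l * w a ω * X a ω) := by
            simp only [hg, hc]; rw [← Real.exp_add]; ring_nf
          have h2 := exp_mul_le_chord (hX a ω).1 (hX a ω).2 (l * w a ω)
          have h3 := mul_le_mul_of_nonneg_left h2 (hB0 ω)
          calc g a ω * H ω = B ω * Real.exp (l * w a ω * X a ω) := by rw [h1]; simp only [hB]; ring
            _ ≤ _ := h3
            _ = _ := by simp only [hB']; ring
      _ = ∫ ω, (B ω + B' ω * m a ω) ∂P := by
          rw [integral_add hBint hB'X, integral_add hBint hB'm,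
            integral_mul_eq_of_condExp (hF a) hXint (hcond a) hB'F hB'le]
      _ ≤ ∫ ω, H ω ∂P := by
          refine integral_mono (hBint.add hB'm) hHint fun ω => ?_
          have h1 := bernoulli_mgf_le (hm a ω).1 (hm a ω).2 (l * w a ω)
          have h2 := mul_le_mul_of_nonneg_left h1 (hB0 ω)
          calc B ω + B' ω * m a ω = B ω * (1 - m a ω + m a ω * Real.exp (l * w a ω)) := by
                simp only [hB']; ring
            _ ≤ _ := h2
            _ = H ω := by
              simp only [hB, hc]; rw [mul_assoc, ← Real.exp_add]; ring_nf; simp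
      _ ≤ 1 := ih

/-- Azuma's inequality for bounded observations with predictable weights. -/
theorem measure_le_sum_weighted [Fintype ι] [IsProbabilityMeasure P] (time : ι → τ)
    (htime : Function.Injective time) {F : ι → MeasurableSpace Ω} (hF : ∀ s, F s ≤ m0)
    (hmono : ∀ s' s, time s' < time s → F s' ≤ F s) {X m w : ι → Ω → ℝ}
    (hXmeas : ∀ s, Measurable (X s)) (hX : ∀ s ω, X s ω ∈ Set.Icc (0 : ℝ) 1)
    (hXF : ∀ s' s, time s' < time s → Measurable[F s] (X s'))
    (hmF : ∀ s, Measurable[F s] (m s)) (hm : ∀ s ω, m s ω ∈ Set.Icc (0 : ℝ) 1)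
    (hcond : ∀ s, P[X s|F s] =ᵐ[P] m s) (hwF : ∀ s, Measurable[F s] (w s)) {V r : ℝ}
    (hV : 0 < V) (hr : 0 ≤ r) (hwV : ∀ ω, ∑ s, w s ω ^ 2 ≤ V) :
    P {ω | r ≤ ∑ s, w s ω * (X s ω - m s ω)} ≤ ENNReal.ofReal (Real.exp (-2 * r ^ 2 / V)) := by
  -- The maximizer of `l * r - l^2 * V / 8`, with maximum `2 * r^2 / V`.
  set l : ℝ := 4 * r / V with hl
  have hl0 : 0 ≤ l := by positivity
  have hK : ∀ s ω, |w s ω| ≤ Real.sqrt V := fun s ω => by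
    rw [← Real.sqrt_sq_eq_abs]
    refine Real.sqrt_le_sqrt (le_trans ?_ (hwV ω))
    exact Finset.single_le_sum (f := fun s => w s ω ^ 2) (fun s _ => sq_nonneg _)
      (Finset.mem_univ s)
  have hle := integral_prod_exp_le_one time htime hF hmono hXmeas hX hXF hmF hm hcond hwF hK l
    Finset.univ
  set g : Ω → ℝ := fun ω =>
    ∏ s, Real.exp (l * w s ω * (X s ω - m s ω) - (l * w s ω) ^ 2 / 8) with hg
  have hg0 : ∀ ω, 0 ≤ g ω := fun ω => Finset.prod_nonneg fun s _ => (Real.exp_pos _).le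
  have hgexp : ∀ ω, g ω = Real.exp (l * ∑ s, w s ω * (X s ω - m s ω)
      - l ^ 2 / 8 * ∑ s, w s ω ^ 2) := fun ω => by
    simp only [hg]
    rw [← Real.exp_sum, Finset.sum_sub_distrib, Finset.mul_sum, Finset.mul_sum]
    congr 2
    · exact Finset.sum_congr rfl fun s _ => by ring
    · exact Finset.sum_congr rfl fun s _ => by ring
  have hgmeas : Measurable g := by
    refine Finset.measurable_fun_prod _ fun s _ => ?_
    have h1 := (hwF s).mono (hF s) le_rfl
    have h2 := (hmF s).mono (hF s) le_rfl
    have h3 := hXmeas s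
    exact Real.measurable_exp.comp
      (((h1.const_mul l).mul (h3.sub h2)).sub (((h1.const_mul l).pow_const 2).div_const 8))
  have hgint : Integrable g P := by
    refine integrable_of_measurable_of_bound hgmeas
      (c := Real.exp (l * ∑ _s : ι, Real.sqrt V * 1)) fun ω => ?_
    rw [abs_of_nonneg (hg0 ω), hgexp]
    refine Real.exp_le_exp.2 ?_
    have h1 : ∑ s, w s ω * (X s ω - m s ω) ≤ ∑ _s : ι, Real.sqrt V * 1 := by
      refine Finset.sum_le_sum fun s _ => (le_abs_self _).trans ?_
      rw [abs_mul]
      refine mul_le_mul (hK s ω) ?_ (abs_nonneg _) (Real.sqrt_nonneg _)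
      rw [abs_le]
      constructor <;> linarith [(hX s ω).1, (hX s ω).2, (hm s ω).1, (hm s ω).2]
    have h2 : 0 ≤ l ^ 2 / 8 * ∑ s, w s ω ^ 2 :=
      mul_nonneg (by positivity) (Finset.sum_nonneg fun s _ => sq_nonneg _)
    linarith [mul_le_mul_of_nonneg_left h1 hl0]
  set κ : ℝ := Real.exp (2 * r ^ 2 / V) with hκ
  have hκ0 : 0 < κ := Real.exp_pos _
  have hsub : {ω | r ≤ ∑ s, w s ω * (X s ω - m s ω)} ⊆ {ω | κ ≤ g ω} := by
    intro ω hω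
    simp only [Set.mem_ofPred_eq] at hω ⊢
    rw [hgexp, hκ]
    refine Real.exp_le_exp.2 ?_
    have h1 := mul_le_mul_of_nonneg_left hω hl0
    have h2 := mul_le_mul_of_nonneg_left (hwV ω) (show 0 ≤ l ^ 2 / 8 by positivity)
    have h3 : 2 * r ^ 2 / V = l * r - l ^ 2 / 8 * V := by rw [hl]; field_simp; ring
    linarith
  have hmarkov := mul_meas_ge_le_integral_of_nonneg (Filter.Eventually.of_forall hg0) hgint κ
  have h4 : P.real {ω | κ ≤ g ω} ≤ Real.exp (-2 * r ^ 2 / V) := by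
    have h5 : Real.exp (-2 * r ^ 2 / V) = 1 / κ := by
      rw [hκ, one_div, ← Real.exp_neg]; ring_nf
    rw [h5, le_div_iff₀ hκ0, mul_comm]
    exact hmarkov.trans hle
  calc P {ω | r ≤ ∑ s, w s ω * (X s ω - m s ω)} ≤ P {ω | κ ≤ g ω} := measure_mono hsub
    _ = ENNReal.ofReal (P.real {ω | κ ≤ g ω}) := by simp
    _ ≤ _ := ENNReal.ofReal_le_ofReal h4

end Azuma

/-! ### Mixed strategies and dominance -/

section Products

variable {N : ℕ} {A : Fin N → ℕ}

theorem pureStrat_mem {n : ℕ} (a : Fin n) : pureStrat a ∈ stdSimplex ℝ (Fin n) :=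
  single_mem_stdSimplex ℝ a

theorem pureStrat_apply {n : ℕ} (a c : Fin n) : pureStrat a c = if c = a then 1 else 0 :=
  Pi.single_apply a 1 c

theorem prodDist_update (x : PlayerVec A) (i : Fin N) (y : Fin (A i) → ℝ) (b : Profile A) :
    prodDist (Function.update x i y) b = y (b i) * ∏ j ∈ Finset.univ.erase i, x j (b j) := by
  unfold prodDist
  rw [← Finset.mul_prod_erase Finset.univ _ (Finset.mem_univ i), Function.update_self]
  congr 1
  refine Finset.prod_congr rfl fun j hj => ?_
  rw [Function.update_of_ne (Finset.ne_of_mem_erase hj)]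

theorem prodDist_eq_mul (x : PlayerVec A) (i : Fin N) (b : Profile A) :
    prodDist x b = x i (b i) * ∏ j ∈ Finset.univ.erase i, x j (b j) := by
  rw [← prodDist_update, Function.update_eq_self]

theorem sum_prodDist (x : PlayerVec A) : ∑ b, prodDist x b = ∏ j, ∑ c, x j c := by
  unfold prodDist
  rw [Finset.prod_univ_sum, Fintype.piFinset_univ]

theorem prodDist_mem {x : PlayerVec A} (hx : ∀ i, x i ∈ stdSimplex ℝ (Fin (A i))) :
    prodDist x ∈ stdSimplex ℝ (Profile A) :=
  ⟨fun b => Finset.prod_nonneg fun j _ => (hx j).1 _, by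
    rw [sum_prodDist]; exact Finset.prod_eq_one fun j _ => (hx j).2⟩

theorem update_mem {x : PlayerVec A} (hx : ∀ i, x i ∈ stdSimplex ℝ (Fin (A i))) {i : Fin N}
    {y : Fin (A i) → ℝ} (hy : y ∈ stdSimplex ℝ (Fin (A i))) (j : Fin N) :
    Function.update x i y j ∈ stdSimplex ℝ (Fin (A j)) := by
  rcases eq_or_ne j i with rfl | h
  · rwa [Function.update_self]
  · rw [Function.update_of_ne h]; exact hx j

/-- Integrating out all coordinates but one of a product distribution. -/
theorem sum_prodDist_mul {x : PlayerVec A} (hx : ∀ i, x i ∈ stdSimplex ℝ (Fin (A i))) (i : Fin N)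
    (f : Fin (A i) → ℝ) : ∑ b, prodDist x b * f (b i) = ∑ c, x i c * f c := by
  have h : ∀ b, prodDist x b * f (b i)
      = prodDist (Function.update x i fun c => x i c * f c) b := fun b => by
    rw [prodDist_update, prodDist_eq_mul x i]; ring
  simp_rw [h]
  rw [sum_prodDist, ← Finset.mul_prod_erase Finset.univ _ (Finset.mem_univ i),
    Function.update_self, Finset.prod_eq_one, mul_one]
  intro j hj
  rw [Function.update_of_ne (Finset.ne_of_mem_erase hj)]
  exact (hx j).2

theorem marginal_prodDist {x : PlayerVec A} (hx : ∀ i, x i ∈ stdSimplex ℝ (Fin (A i))) :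
    marginal (prodDist x) = x := by
  funext i a
  have h := sum_prodDist_mul hx i (fun c => if c = a then 1 else 0)
  simpa [marginal] using h

/-- Overwriting a coordinate of a product distribution by a constant. -/
theorem sum_prodDist_update {x : PlayerVec A} (hx : ∀ i, x i ∈ stdSimplex ℝ (Fin (A i)))
    (i : Fin N) (c : Fin (A i)) (f : Profile A → ℝ) :
    ∑ b, prodDist (Function.update x i (pureStrat c)) b * f b
      = ∑ b, prodDist x b * f (Function.update b i c) := by
  set K : Profile A × Fin (A i) → ℝ := fun q =>
    pureStrat c (q.1 i) * x i q.2 * (∏ j ∈ Finset.univ.erase i, x j (q.1 j)) * f q.1 with hK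
  -- Each profile carries a spare action drawn from `x i`. Swapping it with coordinate `i` is an
  -- involution that turns one side of the identity into the other.
  let e : Profile A × Fin (A i) ≃ Profile A × Fin (A i) :=
    { toFun := fun q => (Function.update q.1 i q.2, q.1 i)
      invFun := fun q => (Function.update q.1 i q.2, q.1 i)
      left_inv := fun q => by simp
      right_inv := fun q => by simp }
  have h1 : ∑ q, K q = ∑ b, prodDist (Function.update x i (pureStrat c)) b * f b := by
    rw [Fintype.sum_prod_type]
    refine Finset.sum_congr rfl fun b _ => ?_
    have : ∀ c', K (b, c') = x i c' * (prodDist (Function.update x i (pureStrat c)) b * f b) :=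
      fun c' => by simp only [hK]; rw [prodDist_update]; ring
    simp_rw [this]
    rw [← Finset.sum_mul, (hx i).2, one_mul]
  have h2 : ∑ q, K (e q) = ∑ b, prodDist x b * f (Function.update b i c) := by
    rw [Fintype.sum_prod_type]
    refine Finset.sum_congr rfl fun b _ => ?_
    have h3 : ∀ c', K (e (b, c')) = if c' = c then prodDist x b * f (Function.update b i c')
        else 0 := fun c' => by
      have h4 : ∏ j ∈ Finset.univ.erase i, x j (Function.update b i c' j)
          = ∏ j ∈ Finset.univ.erase i, x j (b j) := Finset.prod_congr rfl fun j hj => by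
        rw [Function.update_of_ne (Finset.ne_of_mem_erase hj)]
      simp only [hK, e, Equiv.coe_fn_mk, Function.update_self]
      rw [h4, pureStrat_apply, prodDist_eq_mul x i]
      split_ifs <;> ring
    simp_rw [h3]
    simp
  rw [← h1, ← h2]
  exact (Equiv.sum_comp e K).symm

end Products

namespace Game

variable {N : ℕ} {A : Fin N → ℕ} (G : Game A)

theorem payoff_mem {Q : Profile A → ℝ} (hQ : Q ∈ stdSimplex ℝ (Profile A)) (i : Fin N) :
    G.payoff i Q ∈ Set.Icc (0 : ℝ) 1 := by
  constructor
  · exact Finset.sum_nonneg fun b _ => mul_nonneg (hQ.1 b) (G.u_mem i b).1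
  · rw [← hQ.2]
    exact Finset.sum_le_sum fun b _ => mul_le_of_le_one_right (hQ.1 b) (G.u_mem i b).2

/-- Expected utility of player `i` for the action `c` when the others play `x`. -/
noncomputable def devPayoff (i : Fin N) (x : PlayerVec A) (c : Fin (A i)) : ℝ :=
  G.payoff i (prodDist (Function.update x i (pureStrat c)))

theorem devPayoff_mem {x : PlayerVec A} (hx : ∀ i, x i ∈ stdSimplex ℝ (Fin (A i))) (i : Fin N)
    (c : Fin (A i)) : G.devPayoff i x c ∈ Set.Icc (0 : ℝ) 1 :=
  G.payoff_mem (prodDist_mem (update_mem hx (pureStrat_mem c))) i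

theorem devPayoff_eq {x : PlayerVec A} (hx : ∀ i, x i ∈ stdSimplex ℝ (Fin (A i))) (i : Fin N)
    (c : Fin (A i)) : G.devPayoff i x c = ∑ b, prodDist x b * G.u i (Function.update b i c) :=
  sum_prodDist_update hx i c _

theorem payoff_eq_sum_devPayoff (i : Fin N) (x : PlayerVec A) :
    G.payoff i (prodDist x) = ∑ c, x i c * G.devPayoff i x c := by
  unfold devPayoff payoff
  simp_rw [Finset.mul_sum]
  rw [Finset.sum_comm]
  refine Finset.sum_congr rfl fun b _ => ?_
  simp_rw [prodDist_update, pureStrat_apply]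
  rw [Finset.sum_eq_single (b i)]
  · rw [prodDist_eq_mul x i]; simp; ring
  · intro c _ hc; simp [hc.symm]
  · simp

/-- A dominated action falls short by `Δ`, up to the probability that the eliminated actions are
played. -/
theorem le_sum_devPayoff_sub {Δ : ℝ} {E : ∀ j, Set (Fin (A j))} {i : Fin N}
    {a : Fin (A i)} {y : Fin (A i) → ℝ} (hΔ : 0 ≤ Δ) (hy : y ∈ stdSimplex ℝ (Fin (A i)))
    (hdom : ∀ b : Profile A, (∀ j, j ≠ i → b j ∉ E j) →
      G.u i (Function.update b i a) ≤ (∑ c, y c * G.u i (Function.update b i c)) - Δ)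
    {x : PlayerVec A} (hx : ∀ i, x i ∈ stdSimplex ℝ (Fin (A i))) {q : ℝ} (hq0 : 0 ≤ q)
    (hq : ∀ j, ∀ c ∈ E j, x j c ≤ q) :
    Δ - (1 + Δ) * (∑ j, A j * q)
      ≤ ∑ c, y c * G.devPayoff i x c - G.devPayoff i x a := by
  classical
  have h1 : ∑ c, y c * G.devPayoff i x c - G.devPayoff i x a = ∑ b, prodDist x b *
      (∑ c, y c * G.u i (Function.update b i c) - G.u i (Function.update b i a)) := by
    simp_rw [G.devPayoff_eq hx, mul_sub]
    rw [Finset.sum_sub_distrib]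
    congr 1
    simp_rw [Finset.mul_sum]
    rw [Finset.sum_comm]
    exact Finset.sum_congr rfl fun b _ => Finset.sum_congr rfl fun c _ => by ring
  -- If no opponent plays an eliminated action the gain is at least `Δ`; otherwise it is at least
  -- `-1 = Δ - (1 + Δ)`. The number of coordinates in `E` bounds the indicator of the second case;
  -- counting coordinate `i` too only weakens the bound.
  have h2 : ∀ b, Δ - (1 + Δ) * (∑ j, if b j ∈ E j then 1 else 0)
      ≤ ∑ c, y c * G.u i (Function.update b i c) - G.u i (Function.update b i a) := fun b => by
    have hnn : ∀ j, (0 : ℝ) ≤ if b j ∈ E j then 1 else 0 := fun j => by split_ifs <;> norm_num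
    by_cases hb : ∀ j, j ≠ i → b j ∉ E j
    · have := hdom b hb
      have h3 : 0 ≤ (1 + Δ) * ∑ j, (if b j ∈ E j then (1 : ℝ) else 0) :=
        mul_nonneg (by linarith) (Finset.sum_nonneg fun j _ => hnn j)
      linarith
    · push Not at hb
      obtain ⟨j, -, hj⟩ := hb
      have h3 : (1 : ℝ) ≤ ∑ j, (if b j ∈ E j then (1 : ℝ) else 0) := by
        have := Finset.single_le_sum (f := fun j => if b j ∈ E j then (1 : ℝ) else 0)
          (fun j _ => hnn j) (Finset.mem_univ j)
        simpa [hj] using this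
      have h4 : 0 ≤ ∑ c, y c * G.u i (Function.update b i c) :=
        Finset.sum_nonneg fun c _ => mul_nonneg (hy.1 c) (G.u_mem i _).1
      have h5 := (G.u_mem i (Function.update b i a)).2
      nlinarith
  have hQ := prodDist_mem hx
  calc Δ - (1 + Δ) * (∑ j, A j * q)
      ≤ Δ - (1 + Δ) * ∑ j, ∑ b, prodDist x b * (if b j ∈ E j then 1 else 0) := by
        refine sub_le_sub_left (mul_le_mul_of_nonneg_left ?_ (by linarith)) _
        refine Finset.sum_le_sum fun j _ => ?_
        rw [sum_prodDist_mul hx j (fun c => if c ∈ E j then 1 else 0)]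
        calc ∑ c, x j c * (if c ∈ E j then 1 else 0) ≤ ∑ _c : Fin (A j), q := by
              refine Finset.sum_le_sum fun c _ => ?_
              split_ifs with hc
              · simpa using hq j c hc
              · simpa using hq0
          _ = A j * q := by simp
    _ = ∑ b, prodDist x b * (Δ - (1 + Δ) * (∑ j, if b j ∈ E j then 1 else 0)) := by
        rw [Finset.sum_comm]
        simp_rw [mul_sub]
        rw [Finset.sum_sub_distrib, ← Finset.sum_mul, hQ.2, one_mul, Finset.mul_sum]
        congr 1
        refine Finset.sum_congr rfl fun b _ => ?_
        rw [← Finset.mul_sum]; ring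
    _ ≤ _ := by
        rw [h1]
        exact Finset.sum_le_sum fun b _ => mul_le_mul_of_nonneg_left (h2 b) (hQ.1 b)

theorem dominatedGiven_mono (Δ : ℝ) {E E' : ∀ j, Set (Fin (A j))} (h : ∀ j, E j ⊆ E' j)
    (i : Fin N) : G.dominatedGiven Δ E i ⊆ G.dominatedGiven Δ E' i := by
  rintro a ⟨x, hx, hdom⟩
  exact ⟨x, hx, fun b hb => hdom b fun j hj hbj => hb j hj (h j hbj)⟩

theorem elim_subset_succ (Δ : ℝ) (l : ℕ) (i : Fin N) : G.elim Δ l i ⊆ G.elim Δ (l + 1) i := by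
  induction l generalizing i with
  | zero => exact Set.empty_subset _
  | succ l ih => exact G.dominatedGiven_mono Δ ih i

/-- An increasing chain of sets of actions in a finite game stabilizes, so the set in the definition
is nonempty and the infimum is not the default value `0`. -/
theorem elimLength_spec (Δ : ℝ) : 1 ≤ G.elimLength Δ ∧
    G.elim Δ (G.elimLength Δ + 1) = G.elim Δ (G.elimLength Δ) := by
  have hmono : Monotone (G.elim Δ) :=
    monotone_nat_of_le_succ fun l i => G.elim_subset_succ Δ l i
  obtain ⟨n, hn⟩ := WellFoundedGT.monotone_chain_condition ⟨G.elim Δ, hmono⟩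
  have hne : {l | 1 ≤ l ∧ G.elim Δ (l + 1) = G.elim Δ l}.Nonempty :=
    ⟨n + 1, by omega, (hn (n + 1 + 1) (by omega)).symm.trans (hn (n + 1) (by omega))⟩
  exact Nat.sInf_mem hne

end Game

/-! ### Concentration of the observed average payoffs -/

section Bandit

variable {N : ℕ} {A : Fin N → ℕ}

/-- A measurable function of the sequence of observed payoffs that depends only on the rounds
before round `r`. -/
structure IsPredictable {β : Type*} [MeasurableSpace β] (f : (ℕ → PlayerVec A) → β) (r : ℕ) :
    Prop where
  measurable : Measurable f
  congr : ∀ w w' : ℕ → PlayerVec A, (∀ r' < r, w r' = w' r') → f w = f w'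

theorem IsPredictable.comp {β γ : Type*} [MeasurableSpace β] [MeasurableSpace γ]
    {f : (ℕ → PlayerVec A) → β} {r : ℕ} (hf : IsPredictable f r) {g : β → γ} (hg : Measurable g) :
    IsPredictable (fun w => g (f w)) r :=
  ⟨hg.comp hf.measurable, fun w w' h => congrArg g (hf.congr w w' h)⟩

theorem isPredictable_const {β : Type*} [MeasurableSpace β] (b : β) (r : ℕ) :
    IsPredictable (fun _ : ℕ → PlayerVec A => b) r :=
  ⟨measurable_const, fun _ _ _ => rfl⟩

theorem isPredictable_eval {r' r : ℕ} (h : r' < r) :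
    IsPredictable (fun w : ℕ → PlayerVec A => w r') r :=
  ⟨measurable_pi_apply r', fun _ _ hw => hw r' h⟩

theorem Slot.time_injective {R : ℕ} {batch : ℕ → ℕ} :
    Function.Injective (Slot.time : Slot A R batch → _) := by
  rintro ⟨r, i, a, m⟩ ⟨r', i', a', m'⟩ h
  simp only [Slot.time, EmbeddingLike.apply_eq_iff_eq, Prod.mk.injEq] at h
  obtain ⟨h1, h2, h3, h4⟩ := h
  obtain rfl := Fin.ext h1
  obtain rfl := Fin.ext h2
  obtain rfl := Fin.ext h3
  obtain rfl := Fin.ext h4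
  rfl

theorem Slot.time_lt_of_round_lt {R : ℕ} {batch : ℕ → ℕ} {s' s : Slot A R batch}
    (h : (s'.1 : ℕ) < s.1) : s'.time < s.time :=
  Prod.Lex.toLex_lt_toLex.2 (Or.inl h)

variable {R : ℕ} {batch : ℕ → ℕ} {Ω : Type*} {act : Slot A R batch → Ω → Profile A}
  {fb : Slot A R batch → Ω → Fin N → ℝ}

theorem measurable_pair_pastInfo {s' s : Slot A R batch} (h : s'.time < s.time) :
    Measurable[pastInfo act fb s] (fun ω => (act s' ω, fb s' ω)) :=
  Measurable.mono (comap_measurable _)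
    (le_iSup₂ (f := fun (s' : Slot A R batch) (_ : s'.time < s.time) =>
      MeasurableSpace.comap (fun ω => (act s' ω, fb s' ω)) inferInstance) s' h) le_rfl

theorem pastInfo_mono {s' s : Slot A R batch} (h : s'.time < s.time) :
    pastInfo act fb s' ≤ pastInfo act fb s :=
  iSup₂_le fun _ ht => (measurable_pair_pastInfo (ht.trans h)).comap_le

theorem IsPredictable.measurable_avgPayoff {β : Type*} [MeasurableSpace β]
    {f : (ℕ → PlayerVec A) → β} {s : Slot A R batch} (hf : IsPredictable f s.1) :
    Measurable[pastInfo act fb s] (fun ω => f (avgPayoff fb ω)) := by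
  -- Zeroing the present and later rounds leaves `f` unchanged, and what remains is a function of
  -- completed rounds, hence of the past.
  have h : ∀ ω, f (avgPayoff fb ω)
      = f (fun r => if r < (s.1 : ℕ) then avgPayoff fb ω r else 0) := fun ω =>
    hf.congr _ _ fun r hr => by simp [hr]
  simp_rw [h]
  refine hf.measurable.comp ?_
  refine @measurable_pi_lambda _ _ _ (pastInfo act fb s) _ _ fun r => ?_
  by_cases hr : r < (s.1 : ℕ)
  · simp only [hr, if_true]
    refine @measurable_pi_lambda _ _ _ (pastInfo act fb s) _ _ fun i => ?_
    refine @measurable_pi_lambda _ _ _ (pastInfo act fb s) _ _ fun a => ?_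
    simp only [avgPayoff, hr.trans s.1.2, dif_pos]
    refine Measurable.div_const ?_ _
    refine Finset.measurable_fun_sum _ fun m _ => ?_
    have h1 := measurable_pair_pastInfo (act := act) (fb := fb)
      (s' := ⟨⟨r, hr.trans s.1.2⟩, i, a, m⟩) (s := s) (Slot.time_lt_of_round_lt hr)
    exact (measurable_pi_apply i).comp (measurable_snd.comp h1)
  · simp only [hr, if_false]
    exact measurable_const

variable [m0 : MeasurableSpace Ω] {P : Measure Ω} {G : Game A}
  {strat : (ℕ → PlayerVec A) → ℕ → PlayerVec A}

namespace IsBanditRun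

theorem pastInfo_le (h : IsBanditRun G R batch strat P act fb) (s : Slot A R batch) :
    pastInfo act fb s ≤ m0 :=
  iSup₂_le fun s' _ => ((h.measurable_act s').prodMk (h.measurable_fb s')).comap_le

/-- The conditional mean of the feedback of the player whose action is tried out. -/
theorem condExp_fb [IsProbabilityMeasure P] (h : IsBanditRun G R batch strat P act fb)
    (s : Slot A R batch) : P[fun ω => fb s ω s.2.1 | pastInfo act fb s] =ᵐ[P]
      fun ω => G.devPayoff s.2.1 (strat (avgPayoff fb ω) s.1) s.2.2.1 := by
  set j := s.2.1
  have hle : pastInfo act fb s ⊔ MeasurableSpace.comap (act s) inferInstance ≤ m0 :=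
    sup_le (h.pastInfo_le s) (h.measurable_act s).comap_le
  -- Tower property: condition first on the past together with the played profile, then on the past
  -- alone.
  have h1 : P[fun ω => G.u j (act s ω) | pastInfo act fb s]
      =ᵐ[P] P[fun ω => fb s ω j | pastInfo act fb s] :=
    (condExp_congr_ae (h.fb_mean s j).symm).trans
      (condExp_condExp_of_le (f := fun ω => fb s ω j) le_sup_left hle)
  -- Expanding over the finitely many profiles lets the conditional law of the played profile be
  -- applied term by term.
  have h2 : (fun ω => G.u j (act s ω)) = ∑ b : Profile A,
      G.u j b • Set.indicator {ω | act s ω = b} (fun _ => (1 : ℝ)) := by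
    funext ω
    simp only [Finset.sum_apply, Pi.smul_apply, smul_eq_mul]
    rw [Finset.sum_eq_single (act s ω)]
    · simp
    · intro b _ hb
      simp [hb.symm]
    · simp
  have hint : ∀ b : Profile A,
      Integrable (Set.indicator {ω | act s ω = b} (fun _ => (1 : ℝ))) P := fun b =>
    (integrable_const _).indicator (h.measurable_act s (measurableSet_singleton b))
  rw [h2] at h1
  refine h1.symm.trans ((condExp_finsetSum (fun b _ => (hint b).smul _) _).trans ?_)
  have h3 : ∀ᵐ ω ∂P, ∀ b : Profile A,
      P[G.u j b • Set.indicator {ω | act s ω = b} (fun _ => (1 : ℝ)) | pastInfo act fb s] ω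
        = G.u j b * prodDist
          (Function.update (strat (avgPayoff fb ω) s.1) s.2.1 (pureStrat s.2.2.1)) b := by
    rw [ae_all_iff]
    intro b
    filter_upwards [condExp_smul (μ := P) (G.u j b)
      (Set.indicator {ω | act s ω = b} (fun _ => (1 : ℝ))) (pastInfo act fb s),
      h.act_law s b] with ω hω1 hω2
    rw [hω1, Pi.smul_apply, hω2, smul_eq_mul]
  filter_upwards [h3] with ω hω
  rw [Finset.sum_apply]
  simp_rw [hω]
  exact Finset.sum_congr rfl fun b _ => mul_comm _ _

theorem measurable_devPayoff (i : Fin N) (c : Fin (A i)) :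
    Measurable (fun x : PlayerVec A => G.devPayoff i x c) := by
  simp only [Game.devPayoff, Game.payoff, prodDist_update]
  refine Finset.measurable_fun_sum _ fun b _ => ?_
  refine ((Finset.measurable_fun_prod _ fun j _ => ?_).const_mul _).mul_const _
  exact (measurable_pi_apply (b j)).comp (measurable_pi_apply j)

/-- Deviation inequality for predictable combinations of the observed average payoffs. -/
theorem measure_le_sum_deviation [IsProbabilityMeasure P]
    (h : IsBanditRun G R batch strat P act fb)
    (hstrat : ∀ w r i, strat w r i ∈ stdSimplex ℝ (Fin (A i)))
    (hpred : ∀ r, IsPredictable (fun w => strat w r) r)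
    {z : (ℕ → PlayerVec A) → ℕ → PlayerVec A} (hz : ∀ r, IsPredictable (fun w => z w r) r)
    {S : Finset ℕ} (hS : ∀ r ∈ S, r < R) (hbatch : ∀ r ∈ S, 0 < batch r) {B V ρ : ℝ}
    (hB : ∀ w r, ∑ i, ∑ c, z w r i c ^ 2 ≤ B) (hV0 : 0 < V)
    (hV : B * ∑ r ∈ S, 1 / (batch r : ℝ) ≤ V) (hρ : 0 ≤ ρ) :
    P {ω | ρ ≤ ∑ r ∈ S, ∑ i, ∑ c, z (avgPayoff fb ω) r i c *
        (avgPayoff fb ω r i c - G.devPayoff i (strat (avgPayoff fb ω) r) c)}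
      ≤ ENNReal.ofReal (Real.exp (-2 * ρ ^ 2 / V)) := by
  -- An average is spread evenly over its samples. A batch of size `n` then contributes `n * (z /
  -- n)^2 = z^2 / n` to the sum of squared weights.
  set wt : Slot A R batch → Ω → ℝ := fun s ω =>
    if (s.1 : ℕ) ∈ S then z (avgPayoff fb ω) s.1 s.2.1 s.2.2.1 / batch s.1 else 0 with hwt
  have hreindex : ∀ f : ℕ → ℝ, (∑ r : Fin R, if (r : ℕ) ∈ S then f r else 0) = ∑ r ∈ S, f r := by
    intro f
    rw [Fin.sum_univ_eq_sum_range (fun r => if r ∈ S then f r else 0) R, Finset.sum_ite_mem]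
    congr 1
    exact Finset.inter_eq_right.2 fun r hr => Finset.mem_range.2 (hS r hr)
  have hb0 : ∀ r ∈ S, (batch r : ℝ) ≠ 0 := fun r hr => by have := hbatch r hr; positivity
  have hsum : ∀ ω, ∑ s, wt s ω *
      (fb s ω s.2.1 - G.devPayoff s.2.1 (strat (avgPayoff fb ω) s.1) s.2.2.1)
      = ∑ r ∈ S, ∑ i, ∑ c, z (avgPayoff fb ω) r i c *
        (avgPayoff fb ω r i c - G.devPayoff i (strat (avgPayoff fb ω) r) c) := fun ω => by
    rw [← hreindex, Fintype.sum_sigma]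
    refine Finset.sum_congr rfl fun r _ => ?_
    rw [Fintype.sum_sigma]
    split_ifs with hr
    · refine Finset.sum_congr rfl fun i _ => ?_
      rw [Fintype.sum_prod_type]
      refine Finset.sum_congr rfl fun c _ => ?_
      simp only [hwt, hr, if_true]
      rw [← Finset.mul_sum, Finset.sum_sub_distrib]
      have : avgPayoff fb ω r i c = (∑ m, fb ⟨r, i, c, m⟩ ω i) / (batch r : ℝ) := by
        simp [avgPayoff]
      rw [this]
      have := hb0 r hr
      simp only [Finset.sum_const, Finset.card_univ, Fintype.card_fin, nsmul_eq_mul]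
      field_simp
    · simp [hwt, hr]
  have hsq : ∀ ω, ∑ s, wt s ω ^ 2 ≤ V := fun ω => by
    refine le_trans ?_ hV
    rw [Finset.mul_sum, ← hreindex, Fintype.sum_sigma]
    refine Finset.sum_le_sum fun r _ => ?_
    rw [Fintype.sum_sigma]
    split_ifs with hr
    · have hr0 := hb0 r hr
      calc _ = (∑ i, ∑ c, z (avgPayoff fb ω) r i c ^ 2) * (1 / (batch r : ℝ)) := by
            rw [Finset.sum_mul]
            refine Finset.sum_congr rfl fun i _ => ?_
            rw [Fintype.sum_prod_type, Finset.sum_mul]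
            refine Finset.sum_congr rfl fun c _ => ?_
            simp only [hwt, hr, if_true, Finset.sum_const, Finset.card_univ, Fintype.card_fin,
              nsmul_eq_mul]
            field_simp
        _ ≤ _ := mul_le_mul_of_nonneg_right (hB _ _) (by positivity)
    · simp [hwt, hr]
  simp_rw [← hsum]
  refine measure_le_sum_weighted (F := fun s => pastInfo act fb s) Slot.time Slot.time_injective
    h.pastInfo_le (fun _ _ => pastInfo_mono) ?_ (fun s ω => h.fb_mem s ω _) ?_ ?_ ?_
    h.condExp_fb ?_ hV0 hρ hsq
  · exact fun s => (measurable_pi_apply _).comp (h.measurable_fb s)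
  · exact fun s' s hs =>
      (measurable_pi_apply _).comp (measurable_snd.comp (measurable_pair_pastInfo hs))
  · exact fun s => ((hpred s.1).comp (measurable_devPayoff s.2.1 s.2.2.1)).measurable_avgPayoff
  · exact fun s ω => G.devPayoff_mem (hstrat _ _) _ _
  · intro s
    by_cases hs : (s.1 : ℕ) ∈ S
    · simp only [hwt, hs, if_true]
      refine Measurable.div_const ?_ _
      exact ((hz s.1).comp (g := fun x : PlayerVec A => x s.2.1 s.2.2.1)
        ((measurable_pi_apply _).comp (measurable_pi_apply _))).measurable_avgPayoff
    · simp only [hwt, hs, if_false]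
      exact measurable_const

/-- Deviation inequality for predictable combinations of the average payoffs of one player. -/
theorem measure_le_sum_deviation_single [IsProbabilityMeasure P]
    (h : IsBanditRun G R batch strat P act fb)
    (hstrat : ∀ w r i, strat w r i ∈ stdSimplex ℝ (Fin (A i)))
    (hpred : ∀ r, IsPredictable (fun w => strat w r) r) (i : Fin N)
    {z : (ℕ → PlayerVec A) → ℕ → Fin (A i) → ℝ} (hz : ∀ r, IsPredictable (fun w => z w r) r)
    {S : Finset ℕ} (hS : ∀ r ∈ S, r < R) (hbatch : ∀ r ∈ S, 0 < batch r) {B V ρ : ℝ}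
    (hB : ∀ w r, ∑ c, z w r c ^ 2 ≤ B) (hV0 : 0 < V)
    (hV : B * ∑ r ∈ S, 1 / (batch r : ℝ) ≤ V) (hρ : 0 ≤ ρ) :
    P {ω | ρ ≤ ∑ r ∈ S, ∑ c, z (avgPayoff fb ω) r c *
        (avgPayoff fb ω r i c - G.devPayoff i (strat (avgPayoff fb ω) r) c)}
      ≤ ENNReal.ofReal (Real.exp (-2 * ρ ^ 2 / V)) := by
  have hsingle : ∀ (v : Fin (A i) → ℝ) (f : ∀ j, Fin (A j) → ℝ → ℝ), (∀ j c, f j c 0 = 0) →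
      ∑ j, ∑ c, f j c ((Pi.single i v : PlayerVec A) j c) = ∑ c, f i c (v c) := by
    intro v f hf
    rw [Finset.sum_eq_single i]
    · simp
    · intro j _ hj
      simp [Pi.single_eq_of_ne hj, hf]
    · simp
  have key := h.measure_le_sum_deviation hstrat hpred
    (z := fun w r => (Pi.single i (z w r) : PlayerVec A)) (fun r => ?_) hS hbatch (B := B)
    (fun w r => ?_) hV0 hV hρ
  · have hrw : ∀ ω r, ∑ j, ∑ c, (Pi.single i (z (avgPayoff fb ω) r) : PlayerVec A) j c *
        (avgPayoff fb ω r j c - G.devPayoff j (strat (avgPayoff fb ω) r) c)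
        = ∑ c, z (avgPayoff fb ω) r c *
        (avgPayoff fb ω r i c - G.devPayoff i (strat (avgPayoff fb ω) r) c) := fun ω r =>
      hsingle (z (avgPayoff fb ω) r) (fun j c t => t * (avgPayoff fb ω r j c
        - G.devPayoff j (strat (avgPayoff fb ω) r) c)) (by simp)
    simpa only [hrw] using key
  · refine (hz r).comp (g := fun v => (Pi.single i v : PlayerVec A)) ?_
    refine measurable_pi_lambda _ fun j => ?_
    rcases eq_or_ne j i with rfl | hj
    · simp only [Pi.single_eq_same]
      exact measurable_id
    · simp [Pi.single_eq_of_ne hj]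
  · rw [hsingle (z w r) (fun j c t => t ^ 2) (by simp)]
    exact hB w r

end IsBanditRun

end Bandit

/-! ### Exponential weights -/

section Softmax

theorem softmax_mem {n : ℕ} (hn : 0 < n) (v : Fin n → ℝ) : softmax v ∈ stdSimplex ℝ (Fin n) := by
  have : Nonempty (Fin n) := ⟨⟨0, hn⟩⟩
  have hpos : 0 < ∑ b, Real.exp (v b) :=
    Finset.sum_pos (fun b _ => Real.exp_pos _) Finset.univ_nonempty
  refine ⟨fun a => div_nonneg (Real.exp_pos _).le hpos.le, ?_⟩
  simp only [softmax]
  rw [← Finset.sum_div, div_self hpos.ne']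

/-- A mixed strategy cannot beat all its pure actions, so a gap against `y` is a gap against a
single action `b`, whose term alone bounds the normalizing sum from below. -/
theorem softmax_le_exp_neg {n : ℕ} {v y : Fin n → ℝ} (hy : y ∈ stdSimplex ℝ (Fin n)) {a : Fin n}
    {D : ℝ} (h : D ≤ ∑ c, y c * v c - v a) : softmax v a ≤ Real.exp (-D) := by
  obtain ⟨b, hb⟩ : ∃ b, ∑ c, y c * v c ≤ v b := by
    by_contra! hcon
    have hlt : ∑ b, y b * v b < ∑ b, y b * ∑ c, y c * v c := by
      obtain ⟨b, -, hb⟩ : ∃ b ∈ Finset.univ, 0 < y b := by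
        by_contra! h0
        have : ∑ b, y b ≤ 0 := Finset.sum_nonpos h0
        linarith [hy.2]
      exact Finset.sum_lt_sum (fun b _ => mul_le_mul_of_nonneg_left (hcon b).le (hy.1 b))
        ⟨b, Finset.mem_univ b, mul_lt_mul_of_pos_left (hcon b) hb⟩
    rw [← Finset.sum_mul, hy.2, one_mul] at hlt
    exact lt_irrefl _ hlt
  have hle : Real.exp (v b) ≤ ∑ c, Real.exp (v c) :=
    Finset.single_le_sum (f := fun c => Real.exp (v c)) (fun c _ => (Real.exp_pos _).le)
      (Finset.mem_univ b)
  calc softmax v a ≤ Real.exp (v a) / Real.exp (v b) :=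
        div_le_div_of_nonneg_left (Real.exp_pos _).le (Real.exp_pos _) hle
    _ = Real.exp (v a - v b) := (Real.exp_sub _ _).symm
    _ ≤ Real.exp (-D) := Real.exp_le_exp.2 (by linarith)

/-- The potential of exponential weights: the scaled log-mean-exp of the cumulated payoffs. -/
noncomputable def hedgePotential {n : ℕ} (η : ℝ) (S : Fin n → ℝ) : ℝ :=
  Real.log (∑ b, 1 / (n : ℝ) * Real.exp (η * S b)) / η

variable {n : ℕ}

theorem hedgePotential_sum_pos (hn : 0 < n) (η : ℝ) (S : Fin n → ℝ) :
    0 < ∑ b, 1 / (n : ℝ) * Real.exp (η * S b) := by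
  have : Nonempty (Fin n) := ⟨⟨0, hn⟩⟩
  exact Finset.sum_pos (fun b _ => by positivity) Finset.univ_nonempty

/-- Power mean inequality with exponent `η / η'`. The weights `1 / n`, which sum to one, are what
make the potential monotone, so a change to a smaller rate between rounds costs nothing. -/
theorem hedgePotential_mono (hn : 0 < n) {η η' : ℝ} (h0 : 0 < η') (h : η' ≤ η) (S : Fin n → ℝ) :
    hedgePotential η' S ≤ hedgePotential η S := by
  have hη : 0 < η := h0.trans_le h
  have hn' : (n : ℝ) ≠ 0 := by positivity
  have key := Real.rpow_arith_mean_le_arith_mean_rpow Finset.univ (fun _ : Fin n => 1 / (n : ℝ))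
    (fun b => Real.exp (η' * S b)) (fun _ _ => by positivity) (by simp [hn'])
    (fun _ _ => (Real.exp_pos _).le) (p := η / η') (by rwa [le_div_iff₀ h0, one_mul])
  have hexp : ∀ b, Real.exp (η' * S b) ^ (η / η') = Real.exp (η * S b) := fun b => by
    rw [← Real.exp_mul]; congr 1; field_simp
  simp_rw [hexp] at key
  have hpos := hedgePotential_sum_pos hn η' S
  have hlog := Real.log_le_log (Real.rpow_pos_of_pos hpos _) key
  rw [Real.log_rpow hpos] at hlog
  unfold hedgePotential
  rw [div_le_div_iff₀ h0 hη]
  calc _ = η / η' * Real.log (∑ b, 1 / (n : ℝ) * Real.exp (η' * S b)) * η' := by field_simp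
    _ ≤ _ := mul_le_mul_of_nonneg_right hlog h0.le

/-- The ratio of consecutive exponential sums is the mean of `exp (η * v)` under the exponential
weights. Hoeffding's lemma bounds its logarithm with error `η^2 / 8`, which is then divided by `η`.
-/
theorem hedgePotential_add_le (hn : 0 < n) {η : ℝ} (hη : 0 < η) (S v : Fin n → ℝ)
    (hv : ∀ c, v c ∈ Set.Icc (0 : ℝ) 1) :
    hedgePotential η (fun c => S c + v c)
      ≤ hedgePotential η S + ∑ c, softmax (fun c => η * S c) c * v c + η / 8 := by
  have hmem := softmax_mem hn (fun c => η * S c)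
  have h1 := sum_mul_exp_le hmem hv η
  have hn' : (0 : ℝ) < n := by positivity
  have : Nonempty (Fin n) := ⟨⟨0, hn⟩⟩
  have hpos : 0 < ∑ b, Real.exp (η * S b) :=
    Finset.sum_pos (fun b _ => Real.exp_pos _) Finset.univ_nonempty
  have hpos' := hedgePotential_sum_pos hn η S
  have h2 : ∑ b, 1 / (n : ℝ) * Real.exp (η * (S b + v b))
      = (∑ b, 1 / (n : ℝ) * Real.exp (η * S b))
        * ∑ c, softmax (fun c => η * S c) c * Real.exp (η * v c) := by
    rw [← Finset.mul_sum, ← Finset.mul_sum, mul_assoc]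
    congr 1
    rw [Finset.mul_sum]
    refine Finset.sum_congr rfl fun b _ => ?_
    simp only [softmax]
    rw [mul_add, Real.exp_add]
    field_simp
  have h3 : 0 < ∑ c, softmax (fun c => η * S c) c * Real.exp (η * v c) :=
    Finset.sum_pos (fun c _ => mul_pos (div_pos (Real.exp_pos _) hpos) (Real.exp_pos _))
      Finset.univ_nonempty
  have h4 := Real.log_le_log h3 h1
  rw [Real.log_exp] at h4
  unfold hedgePotential
  rw [h2, Real.log_mul hpos'.ne' h3.ne', add_div, add_assoc]
  refine add_le_add_right ?_ _
  rw [div_le_iff₀ hη]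
  calc _ ≤ _ := h4
    _ = _ := by ring

theorem le_hedgePotential (hn : 0 < n) {η : ℝ} (hη : 0 < η) (S : Fin n → ℝ) (a : Fin n) :
    S a - Real.log n / η ≤ hedgePotential η S := by
  have hn' : (0 : ℝ) < n := by positivity
  have h1 : 1 / (n : ℝ) * Real.exp (η * S a) ≤ ∑ b, 1 / (n : ℝ) * Real.exp (η * S b) :=
    Finset.single_le_sum (f := fun b => 1 / (n : ℝ) * Real.exp (η * S b))
      (fun b _ => by positivity) (Finset.mem_univ a)
  have h2 := Real.log_le_log (by positivity) h1
  rw [Real.log_mul (by positivity) (Real.exp_pos _).ne', Real.log_exp,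
    Real.log_div one_ne_zero hn'.ne', Real.log_one] at h2
  unfold hedgePotential
  rw [le_div_iff₀ hη, sub_mul, div_mul_cancel₀ _ hη.ne']
  linarith

theorem hedgePotential_le (hn : 0 < n) {η : ℝ} (hη : 0 < η) {S : Fin n → ℝ} {M : ℝ}
    (hS : ∀ c, S c ≤ M) : hedgePotential η S ≤ M := by
  have hn' : (n : ℝ) ≠ 0 := by positivity
  have h1 : ∑ b, 1 / (n : ℝ) * Real.exp (η * S b) ≤ ∑ _b : Fin n, 1 / (n : ℝ) * Real.exp (η * M) :=
    Finset.sum_le_sum fun b _ => mul_le_mul_of_nonneg_left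
      (Real.exp_le_exp.2 (mul_le_mul_of_nonneg_left (hS b) hη.le)) (by positivity)
  have h2 : ∑ _b : Fin n, 1 / (n : ℝ) * Real.exp (η * M) = Real.exp (η * M) := by
    simp [hn']
  have h3 := Real.log_le_log (hedgePotential_sum_pos hn η S) (h1.trans_eq h2)
  rw [Real.log_exp] at h3
  unfold hedgePotential
  rw [div_le_iff₀ hη]
  linarith

/-- External regret of exponential weights with a decreasing learning rate, whose first play is
arbitrary. -/
theorem hedge_regret_le {N : ℕ} {A : Fin N → ℕ} (i : Fin N) (hn : 0 < A i) {η : ℕ → ℝ}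
    (hpos : ∀ t, 1 ≤ t → 0 < η t) (hanti : ∀ t, 1 ≤ t → η (t + 1) ≤ η t) (a₀ : Profile A)
    {w : ℕ → PlayerVec A} {T : ℕ} (hT : 1 ≤ T) (hw : ∀ t < T, ∀ c, w t i c ∈ Set.Icc (0 : ℝ) 1)
    (a : Fin (A i)) :
    ∑ t ∈ Finset.range T, (w t i a - ∑ c, hedge η a₀ w t i c * w t i c)
      ≤ 1 + Real.log (A i) / η T + (∑ t ∈ Finset.Ico 1 T, η t) / 8 := by
  set S : ℕ → Fin (A i) → ℝ := fun t c => ∑ τ ∈ Finset.range t, w τ i c with hS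
  -- The induction starts after the first round, since that play is an arbitrary point mass. Payoffs
  -- in `[0, 1]` make this round cost at most the additive `1`.
  have key : ∀ t, 1 ≤ t → t ≤ T → hedgePotential (η t) (S t)
      ≤ 1 + ∑ τ ∈ Finset.range t, ∑ c, hedge η a₀ w τ i c * w τ i c
        + (∑ τ ∈ Finset.Ico 1 t, η τ) / 8 := by
    intro t ht
    induction t, ht using Nat.le_induction with
    | base =>
      intro h1
      have h2 : hedgePotential (η 1) (S 1) ≤ 1 :=
        hedgePotential_le hn (hpos 1 le_rfl) fun c => by simpa [hS] using (hw 0 (by omega) c).2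
      have h3 : 0 ≤ ∑ c, hedge η a₀ w 0 i c * w 0 i c := Finset.sum_nonneg fun c _ =>
        mul_nonneg ((pureStrat_mem (a₀ i)).1 c) (hw 0 (by omega) c).1
      simpa using h2.trans (le_add_of_nonneg_right h3)
    | succ t ht ih =>
      intro hlt
      have ih := ih (by omega)
      have h1 := hedgePotential_mono hn (hpos (t + 1) (by omega)) (hanti t ht) (S (t + 1))
      have h2 := hedgePotential_add_le hn (hpos t ht) (S t) (w t i) (hw t (by omega))
      have h3 : S (t + 1) = fun c => S t c + w t i c :=
        funext fun c => Finset.sum_range_succ _ _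
      have h4 : softmax (fun c => η t * S t c) = hedge η a₀ w t i := by
        -- The iterate with index `t` uses rate `η t` and the payoffs with indices below `t`, so it
        -- is exactly the softmax in the potential step.
        obtain ⟨s, rfl⟩ : ∃ s, t = s + 1 := ⟨t - 1, by omega⟩
        rfl
      rw [h4, ← h3] at h2
      rw [Finset.sum_range_succ, Finset.sum_Ico_succ_top ht]
      linarith
  have h1 := key T hT le_rfl
  have h2 := le_hedgePotential hn (hpos T hT) (S T) a
  rw [Finset.sum_sub_distrib]
  have h3 : S T a = ∑ t ∈ Finset.range T, w t i a := rfl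
  linarith

end Softmax

/-! ### Clipping -/

section Clip

variable {n : ℕ} {p : ℝ} {x : Fin n → ℝ}

theorem one_sub_le_sum_clip (hx : x ∈ stdSimplex ℝ (Fin n)) (hp : 0 ≤ p) :
    1 - n * p ≤ ∑ b, (if x b < p then 0 else x b) := by
  have h : ∑ b, (x b - p) ≤ ∑ b, (if x b < p then 0 else x b) :=
    Finset.sum_le_sum fun b _ => by split_ifs <;> linarith
  rw [Finset.sum_sub_distrib, hx.2] at h
  simpa using h

theorem clip_mem (hx : x ∈ stdSimplex ℝ (Fin n)) (hp : 0 ≤ p) (hnp : n * p < 1) :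
    clip p x ∈ stdSimplex ℝ (Fin n) := by
  have hpos : 0 < ∑ b, (if x b < p then 0 else x b) := by
    linarith [one_sub_le_sum_clip hx hp]
  refine ⟨fun a => div_nonneg ?_ hpos.le, ?_⟩
  · split_ifs
    exacts [le_rfl, hx.1 a]
  · simp only [clip]
    rw [← Finset.sum_div, div_self hpos.ne']

/-- Truncation removes the mass `1 - ∑ k`, at most `n * p`, and renormalization puts the same mass
back; each contributes once. -/
theorem sum_abs_clip_sub_le (hx : x ∈ stdSimplex ℝ (Fin n)) (hp : 0 ≤ p) (hnp : n * p < 1) :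
    ∑ a, |clip p x a - x a| ≤ 2 * (n * p) := by
  set k : Fin n → ℝ := fun b => if x b < p then 0 else x b with hk
  have hle := one_sub_le_sum_clip hx hp
  have hpos : 0 < ∑ b, k b := by linarith
  have hk0 : ∀ b, 0 ≤ k b := fun b => by
    simp only [hk]; split_ifs
    exacts [le_rfl, hx.1 b]
  have hkx : ∀ b, k b ≤ x b := fun b => by
    simp only [hk]; split_ifs
    exacts [hx.1 b, le_rfl]
  have hs1 : ∑ b, k b ≤ 1 := hx.2 ▸ Finset.sum_le_sum fun b _ => hkx b
  have h1 : ∀ a, |clip p x a - x a| ≤ (k a / (∑ b, k b) - k a) + (x a - k a) := fun a => by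
    have h2 : k a ≤ k a / ∑ b, k b := by
      rw [le_div_iff₀ hpos]; exact mul_le_of_le_one_right (hk0 a) hs1
    have h3 : clip p x a = k a / ∑ b, k b := rfl
    have h4 := hkx a
    rw [h3, abs_le]
    constructor <;> linarith
  refine (Finset.sum_le_sum fun a _ => h1 a).trans ?_
  rw [Finset.sum_add_distrib, Finset.sum_sub_distrib, Finset.sum_sub_distrib, ← Finset.sum_div,
    div_self hpos.ne', hx.2]
  linarith

theorem le_of_clip_ne_zero {a : Fin n} (h : clip p x a ≠ 0) : p ≤ x a := by
  by_contra! hlt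
  exact h (by simp [clip, hlt])

end Clip

/-! ### Analysis of CCE Hedge on the event that all deviations are small -/

/-- Every weight vector used for concentration is a difference of two mixed strategies. This bound
keeps the variance free of the number of actions. -/
theorem sum_sq_sub_le_two {n : ℕ} {x y : Fin n → ℝ} (hx : x ∈ stdSimplex ℝ (Fin n))
    (hy : y ∈ stdSimplex ℝ (Fin n)) : ∑ c, (x c - y c) ^ 2 ≤ 2 := by
  have h1 : ∀ c, (x c - y c) ^ 2 ≤ x c + y c := fun c => by
    have hxc := (mem_Icc_of_mem_stdSimplex hx c)
    have hyc := (mem_Icc_of_mem_stdSimplex hy c)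
    nlinarith [hxc.1, hxc.2, hyc.1, hyc.2, mul_nonneg hxc.1 hyc.1]
  refine (Finset.sum_le_sum fun c _ => h1 c).trans ?_
  rw [Finset.sum_add_distrib, hx.2, hy.2]; norm_num

theorem sum_pureStrat_mul {n : ℕ} (a : Fin n) (f : Fin n → ℝ) :
    ∑ c, pureStrat a c * f c = f a := by
  simp [pureStrat_apply]

theorem avgPayoff_mem {N : ℕ} {A : Fin N → ℕ} {R : ℕ} {batch : ℕ → ℕ} {Ω : Type*}
    {fb : Slot A R batch → Ω → Fin N → ℝ} (hfb : ∀ s ω j, fb s ω j ∈ Set.Icc (0 : ℝ) 1) (ω : Ω)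
    (r : ℕ) (i : Fin N) (a : Fin (A i)) : avgPayoff fb ω r i a ∈ Set.Icc (0 : ℝ) 1 := by
  unfold avgPayoff
  split_ifs with h
  · refine ⟨div_nonneg (Finset.sum_nonneg fun m _ => (hfb _ _ _).1) (Nat.cast_nonneg _),
      div_le_one_of_le₀ ?_ (Nat.cast_nonneg _)⟩
    simpa using Finset.sum_le_sum fun (m : Fin (batch r)) (_ : m ∈ Finset.univ) =>
      (hfb ⟨⟨r, h⟩, i, a, m⟩ ω i).2
  · simp

/-! ### Two-player games: averaging strategies and zero-sum equilibria -/

section TwoPlayers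

variable {A : Fin 2 → ℕ}

theorem prod_erase_of_ne {i j : Fin 2} (hij : j ≠ i) (f : Fin 2 → ℝ) :
    ∏ k ∈ Finset.univ.erase i, f k = f j := by
  have : (Finset.univ : Finset (Fin 2)).erase i = {j} := by
    ext k
    simp only [Finset.mem_erase, Finset.mem_univ, and_true, Finset.mem_singleton]
    omega
  rw [this, Finset.prod_singleton]

namespace Game

variable (G : Game A)

theorem devPayoff_eq_of_ne {i j : Fin 2} (hij : j ≠ i) (x : PlayerVec A) (a : Fin (A i)) :
    G.devPayoff i x a = ∑ b : Profile A, pureStrat a (b i) * x j (b j) * G.u i b := by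
  unfold devPayoff payoff
  refine Finset.sum_congr rfl fun b _ => ?_
  rw [prodDist_update, prod_erase_of_ne hij fun k => x k (b k)]

theorem devPayoff_le_add {i j : Fin 2} (hij : j ≠ i) (x x' : PlayerVec A) (a : Fin (A i)) :
    G.devPayoff i x a ≤ G.devPayoff i x' a + ∑ c, |x j c - x' j c| := by
  set X : PlayerVec A := fun k c => |x k c - x' k c| with hX
  have h1 : ∑ b : Profile A, pureStrat a (b i) * X j (b j) = ∑ c, X j c := by
    have h2 : ∀ b : Profile A, pureStrat a (b i) * X j (b j)
        = prodDist (Function.update X i (pureStrat a)) b := fun b => by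
      rw [prodDist_update, prod_erase_of_ne hij fun k => X k (b k)]
    simp_rw [h2]
    rw [sum_prodDist, ← Finset.mul_prod_erase Finset.univ _ (Finset.mem_univ i),
      prod_erase_of_ne hij, Function.update_self, Function.update_of_ne hij, (pureStrat_mem a).2,
      one_mul]
  rw [← sub_le_iff_le_add']
  calc G.devPayoff i x a - G.devPayoff i x' a
      = ∑ b : Profile A, pureStrat a (b i) * (x j (b j) - x' j (b j)) * G.u i b := by
        rw [G.devPayoff_eq_of_ne hij, G.devPayoff_eq_of_ne hij, ← Finset.sum_sub_distrib]
        exact Finset.sum_congr rfl fun b _ => by ring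
    _ ≤ ∑ b : Profile A, pureStrat a (b i) * X j (b j) := by
        refine Finset.sum_le_sum fun b _ => ?_
        rw [mul_assoc]
        refine mul_le_mul_of_nonneg_left ?_ ((pureStrat_mem a).1 _)
        calc (x j (b j) - x' j (b j)) * G.u i b ≤ |x j (b j) - x' j (b j)| * G.u i b :=
              mul_le_mul_of_nonneg_right (le_abs_self _) (G.u_mem i b).1
          _ ≤ _ := mul_le_of_le_one_right (abs_nonneg _) (G.u_mem i b).2
    _ = _ := h1

/-- With a single opponent the deviation payoff is linear in the opponent's strategy, so it commutes
with time averages. -/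
theorem devPayoff_average {i j : Fin 2} (hij : j ≠ i) (x : ℕ → PlayerVec A) (T : ℕ)
    (a : Fin (A i)) : G.devPayoff i (fun k c => (∑ t ∈ Finset.range T, x t k c) / T) a
      = (∑ t ∈ Finset.range T, G.devPayoff i (x t) a) / T := by
  simp_rw [G.devPayoff_eq_of_ne hij]
  rw [Finset.sum_comm, Finset.sum_div]
  refine Finset.sum_congr rfl fun b _ => ?_
  rw [← Finset.sum_mul, ← Finset.mul_sum]
  ring

theorem average_mem {x : ℕ → PlayerVec A} (hx : ∀ t i, x t i ∈ stdSimplex ℝ (Fin (A i))) {T : ℕ}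
    (hT : 1 ≤ T) (i : Fin 2) :
    (fun c => (∑ t ∈ Finset.range T, x t i c) / T) ∈ stdSimplex ℝ (Fin (A i)) := by
  have hT0 : (T : ℝ) ≠ 0 := by positivity
  refine ⟨fun c => div_nonneg (Finset.sum_nonneg fun t _ => (hx t i).1 c) (Nat.cast_nonneg _), ?_⟩
  rw [← Finset.sum_div, Finset.sum_comm, Finset.sum_congr rfl fun t _ => (hx t i).2]
  simp [hT0]

/-- In a zero-sum game, averages of strategies close to those of a no-regret sequence of play form
an approximate equilibrium. -/
theorem IsZeroSum.isNash_average {G : Game A} (hG : G.IsZeroSum) {x x' : ℕ → PlayerVec A}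
    (hx : ∀ t i, x t i ∈ stdSimplex ℝ (Fin (A i)))
    (hx' : ∀ t i, x' t i ∈ stdSimplex ℝ (Fin (A i))) {T : ℕ} (hT : 1 ≤ T) {κ μ : ℝ}
    (hreg : ∀ i a, ∑ t ∈ Finset.range T,
      (G.devPayoff i (x t) a - G.payoff i (prodDist (x t))) ≤ T * κ)
    (hclose : ∀ t i, ∑ c, |x' t i c - x t i c| ≤ μ) :
    G.IsNash (2 * κ + 2 * μ) (fun k c => (∑ t ∈ Finset.range T, x' t k c) / T) := by
  obtain ⟨K, hK⟩ := hG
  have hT0 : (0 : ℝ) < T := by positivity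
  set y : PlayerVec A := fun k c => (∑ t ∈ Finset.range T, x' t k c) / T with hy
  have hymem : ∀ i, y i ∈ stdSimplex ℝ (Fin (A i)) := average_mem hx' hT
  have hsum : ∀ {z : PlayerVec A}, (∀ i, z i ∈ stdSimplex ℝ (Fin (A i))) →
      G.payoff 0 (prodDist z) + G.payoff 1 (prodDist z) = K := fun {z} hz => by
    unfold payoff
    rw [← Finset.sum_add_distrib]
    simp_rw [← mul_add, hK]
    rw [← Finset.sum_mul, (prodDist_mem hz).2, one_mul]
  set U : Fin 2 → ℝ := fun i => (∑ t ∈ Finset.range T, G.payoff i (prodDist (x t))) / T with hU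
  have hUsum : U 0 + U 1 = K := by
    simp only [hU]
    rw [← add_div, ← Finset.sum_add_distrib, Finset.sum_congr rfl fun t _ => hsum (hx t)]
    simp only [Finset.sum_const, Finset.card_range, nsmul_eq_mul]
    field_simp
  have hdev : ∀ i a, G.devPayoff i y a ≤ U i + κ + μ := fun i a => by
    obtain ⟨j, hij⟩ : ∃ j : Fin 2, j ≠ i := exists_ne i
    rw [hy, G.devPayoff_average hij, div_le_iff₀ hT0]
    have h1 : ∑ t ∈ Finset.range T, G.devPayoff i (x' t) a
        ≤ ∑ t ∈ Finset.range T, (G.devPayoff i (x t) a + μ) := Finset.sum_le_sum fun t _ =>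
      (G.devPayoff_le_add hij _ (x t) a).trans (by linarith [hclose t j])
    have h2 := hreg i a
    rw [Finset.sum_sub_distrib] at h2
    rw [Finset.sum_add_distrib] at h1
    simp only [Finset.sum_const, Finset.card_range, nsmul_eq_mul] at h1
    have h3 : U i * T = ∑ t ∈ Finset.range T, G.payoff i (prodDist (x t)) := by
      simp only [hU]; field_simp
    linarith
  -- Since payoffs sum to `K` and so do the `U i`, the upper bound for the opponent is the lower
  -- bound `U i - κ - μ` for player `i`. Together with `hdev` this leaves the gap `2κ + 2μ`.
  have hpay : ∀ i, G.payoff i (prodDist y) ≤ U i + κ + μ := fun i => by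
    rw [payoff_eq_sum_devPayoff]
    calc _ ≤ ∑ c, y i c * (U i + κ + μ) :=
          Finset.sum_le_sum fun c _ => mul_le_mul_of_nonneg_left (hdev i c) ((hymem i).1 c)
      _ = _ := by rw [← Finset.sum_mul, (hymem i).2, one_mul]
  refine ⟨hymem, fun i a => ?_⟩
  have h1 := hdev i a
  have h2 := hpay 0
  have h3 := hpay 1
  have h4 := hsum hymem
  change G.devPayoff i y a - _ ≤ _
  fin_cases i
  · simp only [Fin.zero_eta] at h1 ⊢; linarith
  · simp only [Fin.mk_one] at h1 ⊢; linarith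

end Game

end TwoPlayers

theorem le_maxActions {N : ℕ} (A : Fin N → ℕ) (i : Fin N) : A i ≤ maxActions A :=
  Finset.le_sup (f := A) (Finset.mem_univ i)

namespace CCEHedge

section Strategies

variable {N : ℕ} {A : Fin N → ℕ} {L : ℕ} {Δ ε : ℝ}
  {sel : ∀ i, (Fin (A i) → ℝ) → Fin (A i)} {a₀ : Profile A}

theorem iterate_mem (hA : ∀ i, 0 < A i) (w : ℕ → PlayerVec A) (t : ℕ) (i : Fin N) :
    iterate L Δ ε sel a₀ w t i ∈ stdSimplex ℝ (Fin (A i)) := by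
  cases t with
  | zero => exact pureStrat_mem _
  | succ t => exact softmax_mem (hA i) _

theorem strat_of_lt (w : ℕ → PlayerVec A) {r : ℕ} (h : r < L) :
    strat L Δ ε sel a₀ w r = fun i => pureStrat (bestResponses sel a₀ w r i) :=
  if_pos h

theorem strat_add (w : ℕ → PlayerVec A) (t : ℕ) :
    strat L Δ ε sel a₀ w (L + t) = iterate L Δ ε sel a₀ w t := by
  simp [strat]

theorem strat_mem (hA : ∀ i, 0 < A i) (w : ℕ → PlayerVec A) (r : ℕ) (i : Fin N) :
    strat L Δ ε sel a₀ w r i ∈ stdSimplex ℝ (Fin (A i)) := by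
  unfold strat
  split_ifs
  · exact pureStrat_mem _
  · exact iterate_mem hA w _ i

theorem isPredictable_bestResponses (hsel : IsArgmaxRule sel) (l : ℕ) :
    IsPredictable (fun w => bestResponses sel a₀ w l) l := by
  cases l with
  | zero => exact isPredictable_const a₀ 0
  | succ l =>
    refine (isPredictable_eval (Nat.lt_succ_self l)).comp
      (g := fun v : PlayerVec A => fun i => sel i (v i)) ?_
    exact measurable_pi_lambda _ fun i => (hsel.measurable_sel i).comp (measurable_pi_apply i)

theorem measurable_pureStrat {n : ℕ} : Measurable (pureStrat : Fin n → Fin n → ℝ) :=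
  measurable_of_countable _

theorem measurable_softmax {n : ℕ} : Measurable (softmax : (Fin n → ℝ) → Fin n → ℝ) := by
  refine measurable_pi_lambda _ fun a => ?_
  refine (Real.measurable_exp.comp (measurable_pi_apply a)).div ?_
  exact Finset.measurable_fun_sum _ fun b _ => Real.measurable_exp.comp (measurable_pi_apply b)

theorem isPredictable_iterate (hsel : IsArgmaxRule sel) (t : ℕ) :
    IsPredictable (fun w => iterate L Δ ε sel a₀ w t) (L + t) := by
  cases t with
  | zero =>
    refine (isPredictable_bestResponses hsel L).comp
      (g := fun a : Profile A => fun i => pureStrat (a i)) ?_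
    exact measurable_pi_lambda _ fun i => measurable_pureStrat.comp (measurable_pi_apply i)
  | succ t =>
    constructor
    · refine measurable_pi_lambda _ fun i => measurable_softmax.comp ?_
      refine measurable_pi_lambda _ fun c => Measurable.const_mul ?_ _
      refine Finset.measurable_fun_sum _ fun τ _ => ?_
      exact (measurable_pi_apply c).comp ((measurable_pi_apply i).comp (measurable_pi_apply _))
    · intro w w' hw
      simp only [iterate, hedge]
      funext i
      congr 1
      funext c
      congr 1
      refine Finset.sum_congr rfl fun τ hτ => ?_
      rw [hw (L + τ) (by have := Finset.mem_range.1 hτ; omega)]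

theorem isPredictable_strat (hsel : IsArgmaxRule sel) (r : ℕ) :
    IsPredictable (fun w => strat L Δ ε sel a₀ w r) r := by
  rcases lt_or_ge r L with h | h
  · simp_rw [strat_of_lt _ h]
    refine (isPredictable_bestResponses hsel r).comp
      (g := fun a : Profile A => fun i => pureStrat (a i)) ?_
    exact measurable_pi_lambda _ fun i => measurable_pureStrat.comp (measurable_pi_apply i)
  · obtain ⟨t, rfl⟩ := Nat.exists_eq_add_of_le h
    simp_rw [strat_add]
    exact isPredictable_iterate hsel t

/-- Marginals are linear in the correlated strategy and each mixed product has its factors as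
marginals, so the correlation across rounds plays no role. -/
theorem marginal_output (hA : ∀ i, 0 < A i) {p : ℝ} (hpdef : p = threshold A Δ ε) (hp : 0 ≤ p)
    (hAp : ∀ i, A i * p < 1) (w : ℕ → PlayerVec A) (T : ℕ) :
    marginal (output L T Δ ε sel a₀ w)
      = fun i c => (∑ t ∈ Finset.range T, clip p (iterate L Δ ε sel a₀ w t i) c) / T := by
  funext i c
  have h : ∀ t, clip p (iterate L Δ ε sel a₀ w t i) c
      = marginal (prodDist fun i => clip p (iterate L Δ ε sel a₀ w t i)) i c := fun t => by
    rw [marginal_prodDist fun i => clip_mem (iterate_mem hA w t i) hp (hAp i)]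
  simp_rw [h]
  simp only [marginal, output, ← hpdef]
  rw [Finset.sum_comm, Finset.sum_div]
  refine Finset.sum_congr rfl fun b _ => ?_
  split_ifs <;> simp

end Strategies

section Rate

variable {N : ℕ} {A : Fin N → ℕ} {Δ ε : ℝ}

theorem rate_pos (hΔ : 0 < Δ) (hp0 : 0 < threshold A Δ ε) (hp1 : threshold A Δ ε < 1) {t : ℕ}
    (ht : 1 ≤ t) : 0 < rate A Δ ε t := by
  refine lt_max_of_lt_right (div_pos (mul_pos (by norm_num) (Real.log_pos ?_)) (by positivity))
  rwa [lt_div_iff₀ hp0, one_mul]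

theorem rate_succ_le (hΔ : 0 < Δ) (hp0 : 0 < threshold A Δ ε) (hp1 : threshold A Δ ε < 1) {t : ℕ}
    (ht : 1 ≤ t) : rate A Δ ε (t + 1) ≤ rate A Δ ε t := by
  have ht0 : (0 : ℝ) < t := by positivity
  have hle : (t : ℝ) ≤ ((t + 1 : ℕ) : ℝ) := by push_cast; linarith
  have hlog : 0 ≤ Real.log (1 / threshold A Δ ε) :=
    Real.log_nonneg (by rw [le_div_iff₀ hp0, one_mul]; exact hp1.le)
  refine max_le_max (Real.sqrt_le_sqrt ?_) ?_
  · exact div_le_div_of_nonneg_left (Real.log_natCast_nonneg _) ht0 hle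
  · exact div_le_div_of_nonneg_left (by positivity) (by positivity)
      (mul_le_mul_of_nonneg_left hle hΔ.le)

end Rate

section Deterministic

variable {A : Fin 2 → ℕ} {G : Game A} {Δ ε : ℝ} {sel : ∀ i, (Fin (A i) → ℝ) → Fin (A i)}
  {a₀ : Profile A} {w : ℕ → PlayerVec A}

/-- For every action that is eliminated in round `l + 1`, the mixed strategy `y l i a` witnesses
the dominance. -/
def IsDominating (G : Game A) (Δ : ℝ) (y : ℕ → ∀ i, Fin (A i) → Fin (A i) → ℝ) : Prop :=
  ∀ l i a, y l i a ∈ stdSimplex ℝ (Fin (A i)) ∧ (a ∈ G.elim Δ (l + 1) i →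
    ∀ b : Profile A, (∀ j, j ≠ i → b j ∉ G.elim Δ l j) → G.u i (Function.update b i a)
      ≤ (∑ c, y l i a c * G.u i (Function.update b i c)) - Δ)

/-- The witnesses depend on the game only. Fixed before the run, they give deterministic weights,
and a union bound over actions and rounds is enough. Actions that are not eliminated get a dummy
value. -/
theorem exists_isDominating (G : Game A) (Δ : ℝ) : ∃ y, IsDominating G Δ y := by
  have h : ∀ l i (a : Fin (A i)), ∃ y ∈ stdSimplex ℝ (Fin (A i)), (a ∈ G.elim Δ (l + 1) i →
      ∀ b : Profile A, (∀ j, j ≠ i → b j ∉ G.elim Δ l j) → G.u i (Function.update b i a)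
        ≤ (∑ c, y c * G.u i (Function.update b i c)) - Δ) := by
    intro l i a
    by_cases ha : a ∈ G.elim Δ (l + 1) i
    · obtain ⟨y, hy, hdom⟩ := ha
      exact ⟨y, hy, fun _ => hdom⟩
    · exact ⟨pureStrat a, pureStrat_mem a, fun h => absurd h ha⟩
  choose y hy using h
  exact ⟨y, hy⟩

variable {y : ℕ → ∀ i, Fin (A i) → Fin (A i) → ℝ}

/-- An empirical maximizer does at least as well as the dominating mixture on the observed payoffs,
while its true payoff is lower by `Δ`; a deviation below `Δ / 2` cannot bridge this. -/
theorem bestResponses_notMem_elim (hsel : IsArgmaxRule sel) (hΔ : 0 < Δ)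
    (hy : IsDominating G Δ y) {L : ℕ}
    (hdev : ∀ l < L, ∀ i a, ∑ c, (pureStrat a c - y l i a c) *
      (w l i c - G.devPayoff i (strat L Δ ε sel a₀ w l) c) < Δ / 2) :
    ∀ l ≤ L, ∀ i, bestResponses sel a₀ w l i ∉ G.elim Δ l i := by
  intro l
  induction l with
  | zero => exact fun _ _ => Set.notMem_empty _
  | succ l ih =>
    intro hl i hmem
    set a := bestResponses sel a₀ w (l + 1) i with ha
    have ih := ih (by omega)
    have h1 := hdev l hl i a
    rw [strat_of_lt _ hl] at h1
    -- By induction the current point masses avoid the eliminated actions, so `q = 0` and the full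
    -- gap `Δ` survives.
    have h2 := G.le_sum_devPayoff_sub (q := 0) hΔ.le (hy l i a).1 ((hy l i a).2 hmem)
      (x := fun i => pureStrat (bestResponses sel a₀ w l i)) (fun i => pureStrat_mem _) le_rfl
      (fun j c hc => by
        rw [pureStrat_apply, if_neg]
        rintro rfl
        exact ih j hc)
    have h3 : ∑ c, y l i a c * w l i c ≤ w l i a := by
      calc _ ≤ ∑ c, y l i a c * w l i a := Finset.sum_le_sum fun c _ =>
            mul_le_mul_of_nonneg_left (hsel.le_sel i (w l i) c) ((hy l i a).1.1 c)
        _ = _ := by rw [← Finset.sum_mul, (hy l i a).1.2, one_mul]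
    simp_rw [sub_mul, mul_sub] at h1
    simp only [Finset.sum_sub_distrib, sum_pureStrat_mul] at h1
    simp only [mul_zero, Finset.sum_const_zero, sub_zero] at h2
    linarith

theorem iterate_lt_threshold (hΔ : 0 < Δ) (hΔ1 : Δ ≤ 1) (hA : ∀ i, 0 < A i)
    (hy : IsDominating G Δ y) {L T : ℕ} (hL : G.elim Δ (L + 1) = G.elim Δ L)
    (hp0 : 0 < threshold A Δ ε) (hp1 : threshold A Δ ε < 1)
    (hAp : ∀ i, A i * threshold A Δ ε ≤ Δ / 16)
    (hbr : ∀ i, bestResponses sel a₀ w L i ∉ G.elim Δ L i)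
    (hdev : ∀ t < T, 1 ≤ t → ∀ i a, ∑ τ ∈ Finset.Ico L (L + t),
      ∑ c, (pureStrat a c - y L i a c) *
      (w τ i c - G.devPayoff i (strat L Δ ε sel a₀ w τ) c) < t * Δ / 4) :
    ∀ t < T, ∀ i, ∀ a ∈ G.elim Δ L i, iterate L Δ ε sel a₀ w t i a < threshold A Δ ε := by
  set p := threshold A Δ ε with hp
  intro t
  induction t using Nat.strong_induction_on with
  | _ t ih =>
    intro htT i a ha
    rcases Nat.eq_zero_or_pos t with rfl | ht
    · have : iterate L Δ ε sel a₀ w 0 i a = 0 := by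
        simp only [iterate, hedge]
        rw [pureStrat_apply, if_neg]
        rintro rfl
        exact hbr i ha
      rwa [this]
    · have ht0 : (0 : ℝ) < t := by positivity
      have h1 := hdev t htT ht i a
      have hgap : ∀ τ < t, 3 / 4 * Δ ≤
          ∑ c, y L i a c * G.devPayoff i (iterate L Δ ε sel a₀ w τ) c
          - G.devPayoff i (iterate L Δ ε sel a₀ w τ) a := fun τ hτ => by
        -- Stability `E_{L+1} = E_L` makes `a` dominated given the very set whose probabilities the
        -- induction controls. The leakage is at most `(1 + Δ) * 2 * Δ / 16 ≤ Δ / 4`.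
        refine le_trans ?_ (G.le_sum_devPayoff_sub (q := p) hΔ.le (hy L i a).1
          ((hy L i a).2 (by rw [hL]; exact ha)) (iterate_mem hA w τ) hp0.le
          fun j c hc => (ih τ hτ (by omega) j c hc).le)
        rw [Fin.sum_univ_two]
        nlinarith [hAp 0, hAp 1]
      have h2 : ∑ _τ ∈ Finset.range t, 3 / 4 * Δ ≤ _ :=
        Finset.sum_le_sum fun τ hτ => hgap τ (Finset.mem_range.1 hτ)
      rw [Finset.sum_Ico_eq_sum_range, add_tsub_cancel_left] at h1
      simp_rw [strat_add, sub_mul, mul_sub] at h1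
      simp only [Finset.sum_sub_distrib, sum_pureStrat_mul] at h1
      simp only [Finset.sum_const, Finset.card_range, nsmul_eq_mul, Finset.sum_sub_distrib] at h2
      obtain ⟨s, rfl⟩ : ∃ s, t = s + 1 := ⟨t - 1, by omega⟩
      have hrate : 4 * Real.log (1 / p) / (Δ * ((s + 1 : ℕ) : ℝ)) ≤ rate A Δ ε (s + 1) :=
        le_max_right _ _
      have hlog : 0 < Real.log (1 / p) := Real.log_pos (by rwa [lt_div_iff₀ hp0, one_mul])
      have hrpos := rate_pos hΔ hp0 hp1 (Nat.le_add_left 1 s)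
      rw [div_le_iff₀ (by positivity)] at hrate
      -- The observed cumulative gap is at least `(3/4 - 1/4) * t * Δ`; multiplied by the second
      -- branch of the rate, it is at least `2 log (1 / p)`.
      have key : iterate L Δ ε sel a₀ w (s + 1) i a ≤ Real.exp (-(2 * Real.log (1 / p))) := by
        change softmax (fun c => rate A Δ ε (s + 1) *
          ∑ τ ∈ Finset.range (s + 1), w (L + τ) i c) a ≤ _
        refine softmax_le_exp_neg (hy L i a).1 ?_
        have e1 : ∑ c, y L i a c * (rate A Δ ε (s + 1) * ∑ τ ∈ Finset.range (s + 1), w (L + τ) i c)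
            = rate A Δ ε (s + 1) *
              ∑ τ ∈ Finset.range (s + 1), ∑ c, y L i a c * w (L + τ) i c := by
          rw [Finset.sum_comm, Finset.mul_sum]
          refine Finset.sum_congr rfl fun c _ => ?_
          rw [← Finset.mul_sum]; ring
        rw [e1, ← mul_sub]
        have h3 : ((s + 1 : ℕ) : ℝ) * Δ / 2 ≤
            ∑ τ ∈ Finset.range (s + 1), ∑ c, y L i a c * w (L + τ) i c
              - ∑ τ ∈ Finset.range (s + 1), w (L + τ) i a := by
          linarith
        have h4 := mul_le_mul_of_nonneg_left h3 hrpos.le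
        linarith
      refine key.trans_lt ?_
      have e2 : Real.exp (-(2 * Real.log (1 / p))) = p * p := by
        rw [one_div, Real.log_inv, mul_neg, neg_neg, two_mul, Real.exp_add, Real.exp_log hp0]
      rw [e2]
      nlinarith

/-- Regret in true payoffs is regret in observed payoffs plus the deviation sum with the predictable
weights `θ - pureStrat a`. -/
theorem sum_regret_le (hΔ : 0 < Δ) (hA : ∀ i, 0 < A i) {L T : ℕ} (hT : 1 ≤ T)
    (hp0 : 0 < threshold A Δ ε) (hp1 : threshold A Δ ε < 1)
    (hw : ∀ r i c, w r i c ∈ Set.Icc (0 : ℝ) 1) {ρ : ℝ} (i : Fin 2) (a : Fin (A i))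
    (hdev : ∑ τ ∈ Finset.Ico L (L + T), ∑ c, (strat L Δ ε sel a₀ w τ i c - pureStrat a c) *
      (w τ i c - G.devPayoff i (strat L Δ ε sel a₀ w τ) c) < ρ) :
    ∑ t ∈ Finset.range T, (G.devPayoff i (iterate L Δ ε sel a₀ w t) a
        - G.payoff i (prodDist (iterate L Δ ε sel a₀ w t)))
      ≤ 1 + Real.log (A i) / rate A Δ ε T + (∑ t ∈ Finset.Ico 1 T, rate A Δ ε t) / 8 + ρ := by
  have h1 := hedge_regret_le i (hA i) (fun t ht => rate_pos hΔ hp0 hp1 ht)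
    (fun t ht => rate_succ_le hΔ hp0 hp1 ht) (bestResponses sel a₀ w L)
    (w := fun τ => w (L + τ)) hT (fun t _ c => hw _ _ _) a
  change ∑ t ∈ Finset.range T,
    (w (L + t) i a - ∑ c, iterate L Δ ε sel a₀ w t i c * w (L + t) i c) ≤ _ at h1
  rw [Finset.sum_Ico_eq_sum_range, add_tsub_cancel_left] at hdev
  simp_rw [strat_add, sub_mul, mul_sub] at hdev
  simp only [Finset.sum_sub_distrib, sum_pureStrat_mul] at hdev h1 ⊢
  simp_rw [G.payoff_eq_sum_devPayoff]
  linarith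

end Deterministic

end CCEHedge

/-! ### Parameters -/

theorem sum_Ico_inv_sqrt_le (n : ℕ) :
    ∑ t ∈ Finset.Ico 1 (n + 1), 1 / Real.sqrt t ≤ 2 * Real.sqrt n := by
  induction n with
  | zero => simp
  | succ n ih =>
    rw [Finset.sum_Ico_succ_top (by omega)]
    have h1 : 0 < Real.sqrt ((n + 1 : ℕ) : ℝ) := Real.sqrt_pos.2 (by positivity)
    have h2 : Real.sqrt ((n + 1 : ℕ) : ℝ) ^ 2 = n + 1 := by
      rw [Real.sq_sqrt (by positivity)]; push_cast; ring
    have h3 : Real.sqrt (n : ℝ) ^ 2 = n := Real.sq_sqrt (by positivity)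
    have h4 : 1 / Real.sqrt ((n + 1 : ℕ) : ℝ)
        ≤ 2 * Real.sqrt ((n + 1 : ℕ) : ℝ) - 2 * Real.sqrt (n : ℝ) := by
      rw [div_le_iff₀ h1]
      nlinarith [sq_nonneg (Real.sqrt ((n + 1 : ℕ) : ℝ) - Real.sqrt (n : ℝ))]
    linarith

theorem sum_range_inv_le (n : ℕ) :
    ∑ t ∈ Finset.range n, 1 / ((t + 1 : ℕ) : ℝ) ≤ 1 + Real.log n := by
  have h := harmonic_le_one_add_log n
  simpa [harmonic] using h

theorem sum_Ico_inv_le (n : ℕ) :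
    ∑ t ∈ Finset.Ico 1 n, 1 / (t : ℝ) ≤ 1 + Real.log n := by
  rw [Finset.sum_Ico_eq_sum_range]
  calc _ ≤ ∑ t ∈ Finset.range n, 1 / ((t + 1 : ℕ) : ℝ) := by
        refine (Finset.sum_le_sum_of_subset_of_nonneg
          (Finset.range_mono (Nat.sub_le n 1)) fun _ _ _ => by positivity).trans_eq ?_
        exact Finset.sum_congr rfl fun t _ => by rw [add_comm 1 t]
    _ ≤ _ := sum_range_inv_le n

namespace CCEHedge

/-- The maximum is bounded by the sum of its branches. The second branch, needed to suppress
eliminated actions, costs only the harmonic term divided by `Δ`. -/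
theorem sum_rate_le {N : ℕ} {A : Fin N → ℕ} {Δ ε : ℝ} (hΔ : 0 < Δ)
    (hp0 : 0 < threshold A Δ ε) (hp1 : threshold A Δ ε < 1) {T : ℕ} (hT : 1 ≤ T) :
    ∑ t ∈ Finset.Ico 1 T, rate A Δ ε t ≤ 2 * Real.sqrt (T * Real.log (maxActions A))
      + 4 * Real.log (1 / threshold A Δ ε) / Δ * (1 + Real.log T) := by
  have hlog : 0 ≤ Real.log (1 / threshold A Δ ε) :=
    Real.log_nonneg (by rw [le_div_iff₀ hp0, one_mul]; exact hp1.le)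
  have hK : 0 ≤ Real.log (maxActions A) := Real.log_natCast_nonneg _
  calc ∑ t ∈ Finset.Ico 1 T, rate A Δ ε t
      ≤ ∑ t ∈ Finset.Ico 1 T, (Real.sqrt (Real.log (maxActions A)) * (1 / Real.sqrt t)
        + 4 * Real.log (1 / threshold A Δ ε) / Δ * (1 / t)) := by
        refine Finset.sum_le_sum fun t _ => ?_
        have h1 : Real.sqrt (Real.log (maxActions A)) * (1 / Real.sqrt t)
            = Real.sqrt (Real.log (maxActions A) / t) := by
          rw [Real.sqrt_div hK]; ring
        have h2 : 4 * Real.log (1 / threshold A Δ ε) / Δ * (1 / (t : ℝ))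
            = 4 * Real.log (1 / threshold A Δ ε) / (Δ * t) := by
          rw [div_mul_div_comm, mul_one]
        rw [h1, h2]
        exact max_le_add_of_nonneg (Real.sqrt_nonneg _) (by positivity)
    _ ≤ _ := by
        rw [Finset.sum_add_distrib, ← Finset.mul_sum, ← Finset.mul_sum]
        refine add_le_add ?_ (mul_le_mul_of_nonneg_left (sum_Ico_inv_le T) (by positivity))
        obtain ⟨n, rfl⟩ : ∃ n, T = n + 1 := ⟨T - 1, by omega⟩
        have h3 := sum_Ico_inv_sqrt_le n
        have h4 : Real.sqrt (n : ℝ) ≤ Real.sqrt ((n + 1 : ℕ) : ℝ) :=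
          Real.sqrt_le_sqrt (by push_cast; linarith)
        rw [Real.sqrt_mul (by positivity)]
        nlinarith [Real.sqrt_nonneg (Real.log (maxActions A))]

/-- A larger rate only helps here, so the square-root branch suffices. -/
theorem log_div_rate_le {N : ℕ} {A : Fin N → ℕ} {Δ ε : ℝ} {T : ℕ} (hT : 1 ≤ T)
    (hrate : 0 < rate A Δ ε T) {i : Fin N} (hA : 0 < A i) :
    Real.log (A i) / rate A Δ ε T ≤ Real.sqrt (T * Real.log (maxActions A)) := by
  have hT0 : (0 : ℝ) < T := by positivity
  have hK : 0 ≤ Real.log (maxActions A) := Real.log_natCast_nonneg _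
  rw [div_le_iff₀ hrate]
  have h1 : Real.log (A i) ≤ Real.log (maxActions A) :=
    Real.log_le_log (by positivity) (by exact_mod_cast le_maxActions A i)
  have h2 : Real.sqrt (T * Real.log (maxActions A)) * Real.sqrt (Real.log (maxActions A) / T)
      = Real.log (maxActions A) := by
    rw [← Real.sqrt_mul (by positivity)]
    have : T * Real.log (maxActions A) * (Real.log (maxActions A) / T)
        = Real.log (maxActions A) ^ 2 := by field_simp
    rw [this, Real.sqrt_sq hK]
  calc _ ≤ _ := h1
    _ = _ := h2.symm
    _ ≤ _ := mul_le_mul_of_nonneg_left (le_max_left _ _) (Real.sqrt_nonneg _)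

/-- The logarithmic factor of the number of rounds. -/
noncomputable def logFactor (K : ℕ) (Δ ε δ : ℝ) : ℝ := Real.log (2 * K / (Δ * ε * δ))

/-- The number of Hedge rounds. -/
noncomputable def numRounds (K : ℕ) (Δ ε δ : ℝ) : ℕ :=
  ⌈1000 * (1 / ε ^ 2 + 1 / (ε * Δ)) * logFactor K Δ ε δ ^ 2⌉₊

section Parameters

variable {K : ℕ} {Δ ε δ : ℝ}

theorem log_le_logFactor (hK : 1 ≤ K) (hΔ : 0 < Δ) (hΔ1 : Δ ≤ 1) (hε : 0 < ε) (hε1 : ε ≤ 1)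
    (hδ : 0 < δ) : Real.log (2 * K / δ) ≤ logFactor K Δ ε δ := by
  have hK0 : (0 : ℝ) < K := by positivity
  refine Real.log_le_log (by positivity) (div_le_div_of_nonneg_left (by positivity)
    (by positivity) ?_)
  exact mul_le_of_le_one_left hδ.le (mul_le_one₀ hΔ1 hε.le hε1)

theorem log_two_le_log {K : ℕ} {δ : ℝ} (hK : 1 ≤ K) (hδ : 0 < δ) (hδ1 : δ < 1) :
    Real.log 2 ≤ Real.log (2 * K / δ) := by
  refine Real.log_le_log (by norm_num) ?_
  have hK1 : (1 : ℝ) ≤ K := by exact_mod_cast hK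
  rw [le_div_iff₀ hδ]
  nlinarith

theorem lt_logFactor (hK : 1 ≤ K) (hΔ : 0 < Δ) (hΔ1 : Δ ≤ 1) (hε : 0 < ε) (hε1 : ε ≤ 1)
    (hδ : 0 < δ) (hδ1 : δ < 1) : 0.69 < logFactor K Δ ε δ := by
  have h1 := log_le_logFactor hK hΔ hΔ1 hε hε1 hδ
  have h2 := log_two_le_log hK hδ hδ1
  have h3 := Real.log_two_gt_d9
  linarith

theorem log_inv_le_logFactor (hK : 1 ≤ K) (hΔ : 0 < Δ) (hε : 0 < ε) (hδ : 0 < δ) (hδ1 : δ < 1) :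
    Real.log (2 * K / (Δ * ε)) ≤ logFactor K Δ ε δ := by
  have hK0 : (0 : ℝ) < K := by positivity
  refine Real.log_le_log (by positivity) (div_le_div_of_nonneg_left (by positivity)
    (by positivity) ?_)
  exact mul_le_of_le_one_right (by positivity) hδ1.le

theorem le_numRounds : 1000 * (1 / ε ^ 2 + 1 / (ε * Δ)) * logFactor K Δ ε δ ^ 2
    ≤ numRounds K Δ ε δ :=
  Nat.le_ceil _

theorem numRounds_le (hK : 1 ≤ K) (hΔ : 0 < Δ) (hΔ1 : Δ ≤ 1) (hε : 0 < ε) (hε1 : ε ≤ 1)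
    (hδ : 0 < δ) (hδ1 : δ < 1) : (numRounds K Δ ε δ : ℝ)
      ≤ 2000 * (1 / ε ^ 2 + 1 / (ε * Δ)) * logFactor K Δ ε δ ^ 2 := by
  have hΛ := lt_logFactor hK hΔ hΔ1 hε hε1 hδ hδ1
  have h1 : 1 ≤ 1 / ε ^ 2 := by
    rw [le_div_iff₀ (by positivity)]; nlinarith
  have h2 : 0 < 1 / (ε * Δ) := by positivity
  have h3 : (0.4 : ℝ) ≤ logFactor K Δ ε δ ^ 2 := by nlinarith
  have h4 : (0.4 : ℝ) ≤ (1 / ε ^ 2 + 1 / (ε * Δ)) * logFactor K Δ ε δ ^ 2 := by nlinarith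
  have h5 := Nat.ceil_lt_add_one
    (a := 1000 * (1 / ε ^ 2 + 1 / (ε * Δ)) * logFactor K Δ ε δ ^ 2) (by positivity)
  unfold numRounds
  linarith

theorem one_le_numRounds (hK : 1 ≤ K) (hΔ : 0 < Δ) (hΔ1 : Δ ≤ 1) (hε : 0 < ε) (hε1 : ε ≤ 1)
    (hδ : 0 < δ) (hδ1 : δ < 1) : 1 ≤ numRounds K Δ ε δ := by
  have hΛ := lt_logFactor hK hΔ hΔ1 hε hε1 hδ hδ1
  exact Nat.one_le_ceil_iff.2 (by positivity)

theorem log_numRounds_le (hK : 1 ≤ K) (hΔ : 0 < Δ) (hΔ1 : Δ ≤ 1) (hε : 0 < ε) (hε1 : ε ≤ 1)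
    (hδ : 0 < δ) (hδ1 : δ < 1) :
    1 + Real.log (numRounds K Δ ε δ) ≤ 16 * logFactor K Δ ε δ := by
  have hΛ := lt_logFactor hK hΔ hΔ1 hε hε1 hδ hδ1
  have hT1 := one_le_numRounds hK hΔ hΔ1 hε hε1 hδ hδ1
  have hK1 : (1 : ℝ) ≤ K := by exact_mod_cast hK
  set Λ := logFactor K Δ ε δ with hΛdef
  have hX : 2 * K / (Δ * ε) = 2 * (K : ℝ) * (1 / (Δ * ε)) := by ring
  have hΔε : 0 < Δ * ε := by positivity
  have h1 : (1 / ε ^ 2 + 1 / (ε * Δ)) ≤ (2 * K / (Δ * ε)) ^ 2 := by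
    have e1 : 1 / ε ^ 2 ≤ 1 / (Δ * ε) ^ 2 := by
      refine one_div_le_one_div_of_le (by positivity) ?_
      rw [mul_pow]
      exact mul_le_of_le_one_left (by positivity) (pow_le_one₀ hΔ.le hΔ1)
    have e2 : 1 / (ε * Δ) ≤ 1 / (Δ * ε) ^ 2 := by
      refine one_div_le_one_div_of_le (by positivity) ?_
      have : Δ * ε ≤ 1 := mul_le_one₀ hΔ1 hε.le hε1
      nlinarith
    have e3 : (2 * K / (Δ * ε)) ^ 2 = 4 * (K : ℝ) ^ 2 * (1 / (Δ * ε) ^ 2) := by field_simp; ring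
    have e4 : 0 < 1 / (Δ * ε) ^ 2 := by positivity
    rw [e3]
    nlinarith [mul_le_mul_of_nonneg_right (one_le_pow₀ hK1 : (1 : ℝ) ≤ (K : ℝ) ^ 2) e4.le]
  -- With `2000 ≤ 2^11`, taking logarithms gives `11 log 2 + 2Λ + 2 log Λ`, where `log 2 ≤ Λ` and
  -- `log Λ ≤ Λ - 1`.
  have h2 : (numRounds K Δ ε δ : ℝ) ≤ 2 ^ 11 * (2 * K / (Δ * ε)) ^ 2 * Λ ^ 2 := by
    refine (numRounds_le hK hΔ hΔ1 hε hε1 hδ hδ1).trans ?_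
    refine mul_le_mul_of_nonneg_right ?_ (by positivity)
    nlinarith [show (0 : ℝ) < 1 / ε ^ 2 + 1 / (ε * Δ) by positivity]
  have h3 := Real.log_le_log (by positivity) h2
  rw [Real.log_mul (by positivity) (by positivity), Real.log_mul (by positivity) (by positivity),
    Real.log_pow, Real.log_pow, Real.log_pow] at h3
  have h4 := log_inv_le_logFactor hK hΔ hε hδ hδ1
  have h5 := Real.log_le_sub_one_of_pos (show 0 < Λ by linarith)
  have h6 := log_le_logFactor hK hΔ hΔ1 hε hε1 hδ
  have h7 := log_two_le_log hK hδ hδ1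
  push_cast at h3
  linarith

/-- The `1/ε^2` share of the rounds pays for the square-root terms of the regret; one factor of the
logarithm is replaced by its lower bound `0.69`. -/
theorem le_numRounds_mul_sq (hK : 1 ≤ K) (hΔ : 0 < Δ) (hΔ1 : Δ ≤ 1) (hε : 0 < ε) (hε1 : ε ≤ 1)
    (hδ : 0 < δ) (hδ1 : δ < 1) : 690 * logFactor K Δ ε δ ≤ numRounds K Δ ε δ * ε ^ 2 := by
  have hΛ := lt_logFactor hK hΔ hΔ1 hε hε1 hδ hδ1
  have h1 := mul_le_mul_of_nonneg_right (le_numRounds (K := K) (Δ := Δ) (ε := ε) (δ := δ))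
    (sq_nonneg ε)
  refine le_trans ?_ h1
  have h2 : 1000 * (1 / ε ^ 2 + 1 / (ε * Δ)) * logFactor K Δ ε δ ^ 2 * ε ^ 2
      = 1000 * (1 + ε / Δ) * logFactor K Δ ε δ ^ 2 := by field_simp
  rw [h2]
  have h3 : 0 < ε / Δ := by positivity
  nlinarith [mul_pos h3 (show 0 < logFactor K Δ ε δ ^ 2 by positivity)]

/-- The `1/(εΔ)` share of the rounds pays for the regret caused by the raised learning rate. -/
theorem le_numRounds_mul (hK : 1 ≤ K) (hΔ : 0 < Δ) (hΔ1 : Δ ≤ 1) (hε : 0 < ε) (hε1 : ε ≤ 1)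
    (hδ : 0 < δ) (hδ1 : δ < 1) :
    1000 * logFactor K Δ ε δ ^ 2 / Δ ≤ numRounds K Δ ε δ * ε := by
  have hΛ := lt_logFactor hK hΔ hΔ1 hε hε1 hδ hδ1
  have h1 := mul_le_mul_of_nonneg_right (le_numRounds (K := K) (Δ := Δ) (ε := ε) (δ := δ)) hε.le
  refine le_trans ?_ h1
  have h2 : 1000 * (1 / ε ^ 2 + 1 / (ε * Δ)) * logFactor K Δ ε δ ^ 2 * ε
      = 1000 * logFactor K Δ ε δ ^ 2 / ε + 1000 * logFactor K Δ ε δ ^ 2 / Δ := by field_simp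
  rw [h2]
  have h3 : 0 < 1000 * logFactor K Δ ε δ ^ 2 / ε := by positivity
  linarith

theorem sqrt_mul_le {T x ε c : ℝ} (hT : 0 ≤ T) (hε : 0 ≤ ε) (hc : 0 < c)
    (h : c ^ 2 * x ≤ T * ε ^ 2) : Real.sqrt (T * x) ≤ T * ε / c := by
  refine Real.sqrt_le_iff.2 ⟨by positivity, ?_⟩
  rw [div_pow, le_div_iff₀ (by positivity)]
  nlinarith [mul_le_mul_of_nonneg_left h hT]

end Parameters

section Threshold

variable {A : Fin 2 → ℕ} {Δ ε δ : ℝ}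

theorem one_le_maxActions (hA : ∀ i, 0 < A i) : 1 ≤ maxActions A :=
  (hA 0).trans_le (le_maxActions A 0)

theorem threshold_pos (hA : ∀ i, 0 < A i) (hΔ : 0 < Δ) (hε : 0 < ε) : 0 < threshold A Δ ε := by
  have := one_le_maxActions hA
  unfold threshold
  have h := lt_min hε hΔ
  positivity

theorem mul_threshold_le (hA : ∀ i, 0 < A i) (hΔ : 0 < Δ) (hε : 0 < ε) (i : Fin 2) :
    A i * threshold A Δ ε ≤ min ε Δ / 16 := by
  have hK := one_le_maxActions hA
  have hK0 : (0 : ℝ) < maxActions A := by positivity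
  have h1 : (A i : ℝ) ≤ maxActions A := by exact_mod_cast le_maxActions A i
  calc A i * threshold A Δ ε ≤ maxActions A * threshold A Δ ε :=
        mul_le_mul_of_nonneg_right h1 (threshold_pos hA hΔ hε).le
    _ = _ := by
        unfold threshold
        push_cast
        field_simp
        ring

theorem threshold_lt_one (hA : ∀ i, 0 < A i) (hΔ : 0 < Δ) (hΔ1 : Δ ≤ 1) (hε : 0 < ε) :
    threshold A Δ ε < 1 := by
  have h1 := mul_threshold_le hA hΔ hε 0
  have h2 : (1 : ℝ) ≤ A 0 := by exact_mod_cast hA 0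
  have h3 := min_le_right ε Δ
  nlinarith [threshold_pos hA hΔ hε]

theorem log_inv_threshold_le (hA : ∀ i, 0 < A i) (hΔ : 0 < Δ) (hΔ1 : Δ ≤ 1) (hε : 0 < ε)
    (hε1 : ε ≤ 1) (hδ : 0 < δ) (hδ1 : δ < 1) :
    Real.log (1 / threshold A Δ (ε / 2)) ≤ 5 * logFactor (maxActions A) Δ ε δ := by
  have hK := one_le_maxActions hA
  have hK0 : (0 : ℝ) < maxActions A := by positivity
  have h1 : Δ * ε / 2 ≤ min (ε / 2) Δ := by
    refine le_min ?_ ?_ <;> nlinarith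
  have h2 : 1 / threshold A Δ (ε / 2) ≤ 2 ^ 4 * (2 * maxActions A / (Δ * ε)) := by
    have e1 : 2 ^ 4 * (2 * maxActions A / (Δ * ε))
        = 1 / (Δ * ε / 2 / (8 * maxActions A * (2 : ℕ))) := by push_cast; field_simp; norm_num
    rw [e1]
    unfold threshold
    refine one_div_le_one_div_of_le (by positivity) ?_
    exact div_le_div_of_nonneg_right h1 (by positivity)
  have h3 := Real.log_le_log (by have := threshold_pos hA hΔ (half_pos hε); positivity) h2
  rw [Real.log_mul (by positivity) (by positivity), Real.log_pow] at h3
  have h4 := log_inv_le_logFactor hK hΔ hε hδ hδ1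
  have h6 := log_le_logFactor hK hΔ hΔ1 hε hε1 hδ
  have h7 := log_two_le_log hK hδ hδ1
  push_cast at h3
  linarith

/-- The regret bound for the chosen number of rounds. -/
theorem regret_bound_le (hA : ∀ i, 0 < A i) (hΔ : 0 < Δ) (hΔ1 : Δ ≤ 1) (hε : 0 < ε)
    (hε1 : ε ≤ 1) (hδ : 0 < δ) (hδ1 : δ < 1) {T : ℕ}
    (hTdef : T = numRounds (maxActions A) Δ ε δ) (i : Fin 2) :
    1 + Real.log (A i) / rate A Δ (ε / 2) T + (∑ t ∈ Finset.Ico 1 T, rate A Δ (ε / 2) t) / 8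
      + Real.sqrt (T * Real.log (2 * maxActions A / δ)) ≤ T * (2 / 5 * ε) := by
  have hK := one_le_maxActions hA
  have hK0 : (0 : ℝ) < maxActions A := by positivity
  have hp0 := threshold_pos hA hΔ (half_pos hε)
  have hp1 := threshold_lt_one hA hΔ hΔ1 (half_pos hε)
  have hT1 : 1 ≤ T := hTdef ▸ one_le_numRounds hK hΔ hΔ1 hε hε1 hδ hδ1
  have hΛ := lt_logFactor hK hΔ hΔ1 hε hε1 hδ hδ1
  have hlogT := log_numRounds_le hK hΔ hΔ1 hε hε1 hδ hδ1
  have hTsq := le_numRounds_mul_sq hK hΔ hΔ1 hε hε1 hδ hδ1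
  have hTε := le_numRounds_mul hK hΔ hΔ1 hε hε1 hδ hδ1
  rw [← hTdef] at hlogT hTsq hTε
  set Λ := logFactor (maxActions A) Δ ε δ
  have hT0 : (0 : ℝ) ≤ T := Nat.cast_nonneg _
  have h1 := log_div_rate_le hT1 (rate_pos hΔ hp0 hp1 hT1) (hA i)
  have h2 := sum_rate_le hΔ hp0 hp1 hT1
  have h3 := log_inv_threshold_le hA hΔ hΔ1 hε hε1 hδ hδ1
  have hlogQ := log_le_logFactor hK hΔ hΔ1 hε hε1 hδ
  have hlogK : Real.log (maxActions A) ≤ Λ := by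
    refine le_trans (Real.log_le_log hK0 ?_) hlogQ
    rw [le_div_iff₀ hδ]
    nlinarith
  -- Budget in units of `T * ε`: `0.1` for the additive one, `0.08` for the log over rate, `(0.16 +
  -- 0.8) / 8 = 0.12` for the sum of rates and `0.1` for the noise, in total `2/5`.
  have s1 : Real.sqrt (T * Real.log (maxActions A)) ≤ T * ε / 25 * 2 := by
    have := sqrt_mul_le (c := 25 / 2) hT0 hε.le (by norm_num)
      (show (25 / 2 : ℝ) ^ 2 * Real.log (maxActions A) ≤ T * ε ^ 2 by linarith)
    linarith
  have s2 : Real.sqrt (T * Real.log (2 * maxActions A / δ)) ≤ T * ε / 10 :=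
    sqrt_mul_le hT0 hε.le (by norm_num) (by linarith)
  have s3 : 4 * Real.log (1 / threshold A Δ (ε / 2)) / Δ * (1 + Real.log T)
      ≤ 8 * (T * ε / 10) := by
    have e1 : 0 ≤ Real.log T := Real.log_natCast_nonneg _
    calc _ ≤ 4 * (5 * Λ) / Δ * (16 * Λ) := by
          refine mul_le_mul ?_ hlogT (by linarith) (by positivity)
          exact div_le_div_of_nonneg_right (by linarith) hΔ.le
      _ = 320 / 1000 * (1000 * Λ ^ 2 / Δ) := by field_simp; ring
      _ ≤ _ := by nlinarith
  have s4 : 1 ≤ T * ε / 10 := by nlinarith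
  linarith

end Threshold

end CCEHedge

/-! ### Counting the samples -/

namespace CCEHedge

section Batch

variable {N : ℕ} {A : Fin N → ℕ} {L T : ℕ} {Δ δ : ℝ}

theorem le_batch_of_lt {r : ℕ} (hr : r < L) :
    64 * Real.log (maxActions A * N * L / δ) / Δ ^ 2 ≤ batch A L T Δ δ r := by
  rw [batch, if_pos hr]
  exact Nat.le_ceil _

theorem batch_add (t : ℕ) : batch A L T Δ δ (L + t)
    = ⌈64 * Real.log (maxActions A * N * T / δ) / (Δ ^ 2 * ((t + 1 : ℕ) : ℝ))⌉₊ := by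
  rw [batch, if_neg (by omega)]
  simp

theorem le_batch_add (t : ℕ) :
    64 * Real.log (maxActions A * N * T / δ) / (Δ ^ 2 * ((t + 1 : ℕ) : ℝ))
      ≤ batch A L T Δ δ (L + t) := by
  rw [batch_add]
  exact Nat.le_ceil _

theorem numSamples_eq (G : Game A) : (numSamples G T Δ δ : ℝ)
    = (∑ i, (A i : ℝ)) * ∑ r ∈ Finset.range (G.elimLength Δ + T),
      (batch A (G.elimLength Δ) T Δ δ r : ℝ) := by
  unfold numSamples
  rw [Fintype.card_sigma, ← Fin.sum_univ_eq_sum_range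
    (fun r => (batch A (G.elimLength Δ) T Δ δ r : ℝ)), Finset.mul_sum]
  push_cast
  refine Finset.sum_congr rfl fun r _ => ?_
  rw [Fintype.card_sigma, Finset.sum_mul]
  push_cast
  refine Finset.sum_congr rfl fun i _ => ?_
  simp

end Batch

section Samples

variable {A : Fin 2 → ℕ} {Δ ε δ : ℝ}

theorem numSamples_le (hA : ∀ i, 0 < A i) (G : Game A) (hΔ : 0 < Δ) (hΔ1 : Δ ≤ 1) (hε : 0 < ε)
    (hε1 : ε ≤ 1) (hδ : 0 < δ) (hδ1 : δ < 1) :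
    (numSamples G (numRounds (maxActions A) Δ ε δ) Δ δ : ℝ) ≤
      50000 * (G.elimLength Δ * maxActions A / Δ ^ 2 + maxActions A / ε ^ 2) *
        Real.log (2 * maxActions A * G.elimLength Δ / (Δ * ε * δ)) ^ 2 := by
  have hK := one_le_maxActions hA
  have hL := (G.elimLength_spec Δ).1
  have hT1 := one_le_numRounds hK hΔ hΔ1 hε hε1 hδ hδ1
  have hTle := numRounds_le hK hΔ hΔ1 hε hε1 hδ hδ1
  have hlogT := log_numRounds_le hK hΔ hΔ1 hε hε1 hδ hδ1
  have hΛ := lt_logFactor hK hΔ hΔ1 hε hε1 hδ hδ1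
  have hQ := log_le_logFactor hK hΔ hΔ1 hε hε1 hδ
  set K := maxActions A with hKdef
  set T := numRounds K Δ ε δ with hTdef
  set L := G.elimLength Δ with hLdef
  set Λ := logFactor K Δ ε δ with hΛdef
  set Λ' := Real.log (2 * K * L / (Δ * ε * δ)) with hΛ'
  have hK0 : (0 : ℝ) < K := by positivity
  have hL1 : (1 : ℝ) ≤ L := by exact_mod_cast hL
  have hΛΛ' : Λ ≤ Λ' := by
    refine Real.log_le_log (by positivity) (div_le_div_of_nonneg_right ?_ (by positivity))
    exact le_mul_of_one_le_right (by positivity) hL1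
  have hone : 1 ≤ 1 / Δ ^ 2 := by
    rw [le_div_iff₀ (by positivity)]; nlinarith
  have hsumA : ∑ i, (A i : ℝ) ≤ 2 * K := by
    rw [Fin.sum_univ_two]
    have h0 : (A 0 : ℝ) ≤ K := by exact_mod_cast le_maxActions A 0
    have h1 : (A 1 : ℝ) ≤ K := by exact_mod_cast le_maxActions A 1
    linarith
  have hlog1 : Real.log (K * (2 : ℕ) * L / δ) ≤ Λ' := by
    refine Real.log_le_log (by positivity) ?_
    have : (K * (2 : ℕ) * L / δ : ℝ) = 2 * K * L / δ := by push_cast; ring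
    rw [this]
    refine div_le_div_of_nonneg_left (by positivity) (by positivity) ?_
    exact mul_le_of_le_one_left hδ.le (mul_le_one₀ hΔ1 hε.le hε1)
  -- `17 = 1 + 16`: the first part for `2K/δ`, the second for `T`.
  have hlog2 : Real.log (K * (2 : ℕ) * T / δ) ≤ 17 * Λ := by
    have : (K * (2 : ℕ) * T / δ : ℝ) = 2 * K / δ * T := by push_cast; ring
    rw [this, Real.log_mul (by positivity) (by positivity)]
    linarith
  have hfirst : ∑ r ∈ Finset.range L, (batch A L T Δ δ r : ℝ) ≤ 66 / 0.69 * (L / Δ ^ 2 * Λ' ^ 2) := by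
    calc _ ≤ ∑ r ∈ Finset.range L, 66 / 0.69 * (1 / Δ ^ 2 * Λ' ^ 2) := by
          refine Finset.sum_le_sum fun r hr => ?_
          rw [batch, if_pos (Finset.mem_range.1 hr)]
          have hnn : 0 ≤ Real.log (K * (2 : ℕ) * L / δ) := by
            refine Real.log_nonneg ?_
            rw [le_div_iff₀ hδ]
            have hKL : (1 : ℝ) ≤ K * L := by
              exact_mod_cast Nat.mul_pos hK hL
            push_cast
            nlinarith
          refine (Nat.ceil_lt_add_one (by positivity)).le.trans ?_
          have e1 : 64 * Real.log (K * (2 : ℕ) * L / δ) / Δ ^ 2 ≤ 64 * Λ' * (1 / Δ ^ 2) := by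
            rw [mul_one_div]
            exact div_le_div_of_nonneg_right (by linarith) (by positivity)
          -- Since `Λ' > 0.69`, rounding up costs `1 ≤ 2Λ'`, and a further `Λ' / 0.69 ≥ 1` produces
          -- the square.
          have e2 : 64 * Λ' + 1 ≤ 66 / 0.69 * Λ' ^ 2 := by nlinarith
          have e3 := mul_le_mul_of_nonneg_right e2 (show 0 ≤ 1 / Δ ^ 2 by positivity)
          linarith
      _ = _ := by
          simp only [Finset.sum_const, Finset.card_range, nsmul_eq_mul]
          ring
  have hsecond : ∑ t ∈ Finset.range T, (batch A L T Δ δ (L + t) : ℝ)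
      ≤ 64 * (17 * Λ) * (1 / Δ ^ 2) * (16 * Λ) + T := by
    -- Batches decaying like `1/t` sum to a harmonic series; the ceilings add one per round, hence
    -- the extra `T`.
    calc _ ≤ ∑ t ∈ Finset.range T, (64 * (17 * Λ) * (1 / Δ ^ 2) * (1 / ((t + 1 : ℕ) : ℝ)) + 1) := by
          refine Finset.sum_le_sum fun t ht => ?_
          rw [batch_add]
          have hnn : 0 ≤ Real.log (K * (2 : ℕ) * T / δ) := by
            refine Real.log_nonneg ?_
            rw [le_div_iff₀ hδ]
            have hKT : (1 : ℝ) ≤ K * T := by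
              exact_mod_cast Nat.mul_pos hK hT1
            push_cast
            nlinarith
          refine (Nat.ceil_lt_add_one (by positivity)).le.trans ?_
          have e0 : 64 * (17 * Λ) * (1 / Δ ^ 2) * (1 / ((t + 1 : ℕ) : ℝ))
              = 64 * (17 * Λ) / (Δ ^ 2 * ((t + 1 : ℕ) : ℝ)) := by field_simp
          rw [e0]
          refine add_le_add_left ?_ 1
          exact div_le_div_of_nonneg_right (by linarith) (by positivity)
      _ = 64 * (17 * Λ) * (1 / Δ ^ 2) * (∑ t ∈ Finset.range T, 1 / ((t + 1 : ℕ) : ℝ)) + T := by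
          rw [Finset.sum_add_distrib, ← Finset.mul_sum]
          simp
      _ ≤ _ := by
          have := (sum_range_inv_le T).trans hlogT
          have h2 := mul_le_mul_of_nonneg_left this
            (show 0 ≤ 64 * (17 * Λ) * (1 / Δ ^ 2) by positivity)
          linarith
  rw [numSamples_eq, Finset.sum_range_add]
  have hcross : 1 / (ε * Δ) ≤ 1 / ε ^ 2 + 1 / Δ ^ 2 := by
    have := sq_nonneg (1 / ε - 1 / Δ)
    have e : 1 / (ε * Δ) = 1 / ε * (1 / Δ) := by field_simp
    have e1 : 1 / ε ^ 2 = (1 / ε) ^ 2 := by rw [one_div_pow]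
    have e2 : 1 / Δ ^ 2 = (1 / Δ) ^ 2 := by rw [one_div_pow]
    rw [e, e1, e2]
    nlinarith [mul_pos (show 0 < 1 / ε by positivity) (show 0 < 1 / Δ by positivity)]
  have hsq : Λ ^ 2 ≤ Λ' ^ 2 := pow_le_pow_left₀ (by linarith) hΛΛ' 2
  have hT2 : (T : ℝ) ≤ (4000 * (1 / ε ^ 2) + 2000 * (1 / Δ ^ 2)) * Λ' ^ 2 := by
    refine hTle.trans ?_
    refine mul_le_mul ?_ hsq (by positivity) (by positivity)
    linarith
  have h64 : 64 * (17 * Λ) * (1 / Δ ^ 2) * (16 * Λ) ≤ 17408 * (1 / Δ ^ 2) * Λ' ^ 2 := by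
    have := mul_le_mul_of_nonneg_left hsq (show 0 ≤ 17408 * (1 / Δ ^ 2) by positivity)
    linarith
  have hLΔ : 1 / Δ ^ 2 * Λ' ^ 2 ≤ L / Δ ^ 2 * Λ' ^ 2 :=
    mul_le_mul_of_nonneg_right (div_le_div_of_nonneg_right hL1 (by positivity)) (by positivity)
  -- The coefficient of `L/Δ^2` is at most `66/0.69 + 17408 + 2000` and that of `1/ε^2` is `4000`,
  -- using `L ≥ 1`.
  have htotal : ∑ r ∈ Finset.range L, (batch A L T Δ δ r : ℝ)
      + ∑ t ∈ Finset.range T, (batch A L T Δ δ (L + t) : ℝ)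
      ≤ 25000 * (L / Δ ^ 2 + 1 / ε ^ 2) * Λ' ^ 2 := by
    have : 0 ≤ 1 / ε ^ 2 * Λ' ^ 2 := by positivity
    nlinarith
  calc _ ≤ 2 * K * (25000 * (L / Δ ^ 2 + 1 / ε ^ 2) * Λ' ^ 2) :=
        mul_le_mul hsumA htotal (by positivity) (by positivity)
    _ = _ := by ring

end Samples

/-! ### Probability of the three bad events and conclusion -/

section UnionBound

variable {A : Fin 2 → ℕ} {Ω : Type*} [MeasurableSpace Ω] {P : Measure Ω}

theorem measure_iUnion_actions_le {n : ℕ} (hn : 1 ≤ n) (hA : ∀ i, 0 < A i) {δ : ℝ}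
    (hδ : 0 < δ) {E : ℕ → ∀ i, Fin (A i) → Set Ω}
    (hE : ∀ l < n, ∀ i a, P (E l i a) ≤ ENNReal.ofReal (δ / (2 * maxActions A * n))) :
    P (⋃ l ∈ Finset.range n, ⋃ i, ⋃ a, E l i a) ≤ ENNReal.ofReal δ := by
  have hK := one_le_maxActions hA
  set x : ℝ := δ / (2 * maxActions A * n) with hx
  have hx0 : 0 ≤ x := by positivity
  have h1 : ∀ l < n, ∀ i, P (⋃ a, E l i a) ≤ ENNReal.ofReal (maxActions A * x) := by
    intro l hl i
    calc P (⋃ a, E l i a) ≤ ∑ a, P (E l i a) := measure_iUnion_fintype_le _ _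
      _ ≤ ∑ _a : Fin (A i), ENNReal.ofReal x := Finset.sum_le_sum fun a _ => hE l hl i a
      _ = ENNReal.ofReal (A i * x) := by
          simp [ENNReal.ofReal_mul]
      _ ≤ _ := ENNReal.ofReal_le_ofReal (mul_le_mul_of_nonneg_right
          (by exact_mod_cast le_maxActions A i) hx0)
  have h2 : ∀ l < n, P (⋃ i, ⋃ a, E l i a) ≤ ENNReal.ofReal (2 * (maxActions A * x)) := by
    intro l hl
    calc P (⋃ i, ⋃ a, E l i a) ≤ ∑ i, P (⋃ a, E l i a) := measure_iUnion_fintype_le _ _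
      _ ≤ ∑ _i : Fin 2, ENNReal.ofReal (maxActions A * x) :=
          Finset.sum_le_sum fun i _ => h1 l hl i
      _ = _ := by
          rw [ENNReal.ofReal_mul (p := 2) (by norm_num)]
          simp
  calc _ ≤ ∑ l ∈ Finset.range n, P (⋃ i, ⋃ a, E l i a) := measure_biUnion_finset_le _ _
    _ ≤ ∑ _l ∈ Finset.range n, ENNReal.ofReal (2 * (maxActions A * x)) :=
        Finset.sum_le_sum fun l hl => h2 l (Finset.mem_range.1 hl)
    _ = ENNReal.ofReal (n * (2 * (maxActions A * x))) := by
        rw [ENNReal.ofReal_mul (p := (n : ℝ)) (by positivity)]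
        simp
    _ = ENNReal.ofReal δ := by
        congr 1
        rw [hx]
        field_simp

theorem exp_neg_mul_log_le {Q c : ℝ} (hQ : 1 ≤ Q) (hc : 1 ≤ c) :
    Real.exp (-(c * Real.log Q)) ≤ 1 / Q := by
  have h := Real.log_nonneg hQ
  rw [one_div, ← Real.exp_log (show 0 < Q⁻¹ by positivity), Real.log_inv]
  exact Real.exp_le_exp.2 (by nlinarith)

end UnionBound

section Run

variable {A : Fin 2 → ℕ} {G : Game A} {Δ ε δ : ℝ} {sel : ∀ i, (Fin (A i) → ℝ) → Fin (A i)}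
  {a₀ : Profile A} {Ω : Type*} [MeasurableSpace Ω] {P : Measure Ω} [IsProbabilityMeasure P]
  {T : ℕ} {act : Slot A (G.elimLength Δ + T) (batch A (G.elimLength Δ) T Δ δ) → Ω → Profile A}
  {fb : Slot A (G.elimLength Δ + T) (batch A (G.elimLength Δ) T Δ δ) → Ω → Fin 2 → ℝ}
  {y : ℕ → ∀ i, Fin (A i) → Fin (A i) → ℝ}

theorem measure_bestResponse_deviation (hA : ∀ i, 0 < A i) (hΔ : 0 < Δ) (hδ : 0 < δ) (hδ1 : δ < 1)
    (hsel : IsArgmaxRule sel) (hy : IsDominating G Δ y)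
    (hrun : IsRun G T Δ ε δ sel a₀ P act fb) {l : ℕ} (hl : l < G.elimLength Δ) (i : Fin 2)
    (a : Fin (A i)) :
    P {ω | Δ / 2 ≤ ∑ c, (pureStrat a c - y l i a c) * (avgPayoff fb ω l i c -
        G.devPayoff i (strat (G.elimLength Δ) Δ ε sel a₀ (avgPayoff fb ω) l) c)}
      ≤ ENNReal.ofReal (δ / (2 * maxActions A * G.elimLength Δ)) := by
  set L := G.elimLength Δ with hL
  have hK := one_le_maxActions hA
  have hL1 : 1 ≤ L := by omega
  set Q : ℝ := maxActions A * (2 : ℕ) * L / δ with hQdef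
  have hQ1 : 1 < Q := by
    rw [hQdef, lt_div_iff₀ hδ]
    have : (1 : ℝ) ≤ maxActions A * L := by exact_mod_cast Nat.mul_pos hK hL1
    push_cast; nlinarith
  have hlog := Real.log_pos hQ1
  have hb := le_batch_of_lt (A := A) (T := T) (Δ := Δ) (δ := δ) hl
  have hb0 : 0 < 64 * Real.log Q / Δ ^ 2 := by positivity
  have hbpos : (0 : ℝ) < batch A L T Δ δ l := hb0.trans_le hb
  -- `V` is twice the reciprocal of the lower bound on the batch size. The resulting exponent `16
  -- log Q` exceeds the `log Q` that the union bound requires.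
  have key := IsBanditRun.measure_le_sum_deviation_single hrun (strat_mem hA)
    (isPredictable_strat hsel) i (z := fun _ _ c => pureStrat a c - y l i a c)
    (fun r => isPredictable_const _ r) (S := {l}) (by simp; omega)
    (by simpa using hbpos) (B := 2) (V := Δ ^ 2 / (32 * Real.log Q)) (ρ := Δ / 2)
    (fun _ _ => sum_sq_sub_le_two (pureStrat_mem a) (hy l i a).1) (by positivity) ?_ (by positivity)
  · simp only [Finset.sum_singleton] at key
    refine key.trans (ENNReal.ofReal_le_ofReal ?_)
    have e1 : -2 * (Δ / 2) ^ 2 / (Δ ^ 2 / (32 * Real.log Q)) = -(16 * Real.log Q) := by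
      field_simp; norm_num
    rw [e1]
    refine (exp_neg_mul_log_le hQ1.le (by norm_num)).trans_eq ?_
    rw [hQdef, one_div_div, Nat.cast_two, mul_comm (maxActions A : ℝ) 2]
  · rw [Finset.sum_singleton]
    have h1 := one_div_le_one_div_of_le hb0 hb
    calc _ ≤ 2 * (1 / (64 * Real.log Q / Δ ^ 2)) := by linarith
      _ = _ := by field_simp; norm_num

/-- The reciprocal batch sizes grow linearly, so the variance is of order `Δ^2 * t^2 / log Q`,
matching the square of the tolerance `t * Δ / 4` at every `t`; the exponent is `4 log Q`. -/
theorem measure_elimination_deviation (hA : ∀ i, 0 < A i) (hΔ : 0 < Δ) (hδ : 0 < δ) (hδ1 : δ < 1)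
    (hsel : IsArgmaxRule sel) (hy : IsDominating G Δ y)
    (hrun : IsRun G T Δ ε δ sel a₀ P act fb) {t : ℕ} (ht1 : 1 ≤ t) (ht : t ≤ T) (i : Fin 2)
    (a : Fin (A i)) :
    P {ω | t * Δ / 4 ≤ ∑ τ ∈ Finset.Ico (G.elimLength Δ) (G.elimLength Δ + t),
        ∑ c, (pureStrat a c - y (G.elimLength Δ) i a c) * (avgPayoff fb ω τ i c -
        G.devPayoff i (strat (G.elimLength Δ) Δ ε sel a₀ (avgPayoff fb ω) τ) c)}
      ≤ ENNReal.ofReal (δ / (2 * maxActions A * T)) := by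
  set L := G.elimLength Δ with hL
  have hK := one_le_maxActions hA
  have hT1 : 1 ≤ T := ht1.trans ht
  have ht0 : (1 : ℝ) ≤ t := by exact_mod_cast ht1
  set Q : ℝ := maxActions A * (2 : ℕ) * T / δ with hQdef
  have hQ1 : 1 < Q := by
    rw [hQdef, lt_div_iff₀ hδ]
    have : (1 : ℝ) ≤ maxActions A * T := by exact_mod_cast Nat.mul_pos hK hT1
    push_cast; nlinarith
  have hlog := Real.log_pos hQ1
  have hb : ∀ τ, 64 * Real.log Q / (Δ ^ 2 * ((τ + 1 : ℕ) : ℝ)) ≤ batch A L T Δ δ (L + τ) :=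
    fun τ => le_batch_add τ
  have hb0 : ∀ τ : ℕ, 0 < 64 * Real.log Q / (Δ ^ 2 * ((τ + 1 : ℕ) : ℝ)) := fun τ => by positivity
  have key := IsBanditRun.measure_le_sum_deviation_single hrun (strat_mem hA)
    (isPredictable_strat hsel) i (z := fun _ _ c => pureStrat a c - y L i a c)
    (fun r => isPredictable_const _ r) (S := Finset.Ico L (L + t))
    (fun r hr => by have := (Finset.mem_Ico.1 hr).2; omega)
    (fun r hr => by
      obtain ⟨τ, rfl⟩ := Nat.exists_eq_add_of_le (Finset.mem_Ico.1 hr).1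
      have := (hb0 τ).trans_le (hb τ)
      exact_mod_cast this)
    (B := 2) (V := Δ ^ 2 * t ^ 2 / (32 * Real.log Q)) (ρ := t * Δ / 4)
    (fun _ _ => sum_sq_sub_le_two (pureStrat_mem a) (hy L i a).1) (by positivity) ?_ (by positivity)
  · refine key.trans (ENNReal.ofReal_le_ofReal ?_)
    have e1 : -2 * (t * Δ / 4) ^ 2 / (Δ ^ 2 * t ^ 2 / (32 * Real.log Q)) = -(4 * Real.log Q) := by
      field_simp; norm_num
    rw [e1]
    refine (exp_neg_mul_log_le hQ1.le (by norm_num)).trans_eq ?_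
    rw [hQdef]; push_cast; field_simp
  · rw [Finset.sum_Ico_eq_sum_range, add_tsub_cancel_left]
    have h1 : ∑ τ ∈ Finset.range t, 1 / (batch A L T Δ δ (L + τ) : ℝ)
        ≤ ∑ _τ ∈ Finset.range t, Δ ^ 2 * t / (64 * Real.log Q) := by
      refine Finset.sum_le_sum fun τ hτ => (one_div_le_one_div_of_le (hb0 τ) (hb τ)).trans ?_
      rw [one_div_div]
      refine div_le_div_of_nonneg_right (mul_le_mul_of_nonneg_left ?_ (by positivity))
        (by positivity)
      have := Finset.mem_range.1 hτ
      exact_mod_cast (show τ + 1 ≤ t by omega)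
    simp only [Finset.sum_const, Finset.card_range, nsmul_eq_mul] at h1
    calc _ ≤ 2 * (t * (Δ ^ 2 * t / (64 * Real.log Q))) := by linarith
      _ = _ := by field_simp; norm_num

/-- Batches of size at least one suffice, giving variance `2T`. Only the sum over all rounds
matters, so the union bound runs over players and actions alone, whence the factor `1`. -/
theorem measure_regret_deviation (hA : ∀ i, 0 < A i) (hΔ : 0 < Δ) (hδ : 0 < δ) (hδ1 : δ < 1)
    (hT1 : 1 ≤ T) (hsel : IsArgmaxRule sel) (hrun : IsRun G T Δ ε δ sel a₀ P act fb) (i : Fin 2)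
    (a : Fin (A i)) :
    P {ω | Real.sqrt (T * Real.log (2 * maxActions A / δ)) ≤
        ∑ τ ∈ Finset.Ico (G.elimLength Δ) (G.elimLength Δ + T),
        ∑ c, (strat (G.elimLength Δ) Δ ε sel a₀ (avgPayoff fb ω) τ i c - pureStrat a c) *
        (avgPayoff fb ω τ i c -
        G.devPayoff i (strat (G.elimLength Δ) Δ ε sel a₀ (avgPayoff fb ω) τ) c)}
      ≤ ENNReal.ofReal (δ / (2 * maxActions A * (1 : ℕ))) := by
  set L := G.elimLength Δ with hL
  have hK := one_le_maxActions hA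
  have hT0 : (0 : ℝ) < T := by positivity
  have hlogpos : 0 < Real.log (2 * maxActions A / δ) :=
    (Real.log_pos (by norm_num)).trans_le (log_two_le_log hK hδ hδ1)
  have hQ1 : (1 : ℝ) ≤ 2 * maxActions A / δ := by
    rw [le_div_iff₀ hδ]
    have : (1 : ℝ) ≤ maxActions A := by exact_mod_cast hK
    linarith
  have hb1 : ∀ τ, 1 ≤ batch A L T Δ δ (L + τ) := fun τ => by
    rw [batch_add, Nat.one_le_ceil_iff]
    have : 0 < Real.log (maxActions A * (2 : ℕ) * T / δ) := by
      refine Real.log_pos ?_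
      rw [lt_div_iff₀ hδ]
      have : (1 : ℝ) ≤ maxActions A * T := by exact_mod_cast Nat.mul_pos hK hT1
      push_cast; nlinarith
    positivity
  have key := IsBanditRun.measure_le_sum_deviation_single hrun (strat_mem hA)
    (isPredictable_strat hsel) i
    (z := fun w r c => strat L Δ ε sel a₀ w r i c - pureStrat a c)
    (fun r => (isPredictable_strat hsel r).comp
      (g := fun x : PlayerVec A => fun c => x i c - pureStrat a c)
      (measurable_pi_lambda _ fun c =>
        ((measurable_pi_apply c).comp (measurable_pi_apply i)).sub_const _))
    (S := Finset.Ico L (L + T)) (fun r hr => (Finset.mem_Ico.1 hr).2)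
    (fun r hr => by
      obtain ⟨τ, rfl⟩ := Nat.exists_eq_add_of_le (Finset.mem_Ico.1 hr).1
      exact hb1 τ)
    (B := 2) (V := 2 * T) (ρ := Real.sqrt (T * Real.log (2 * maxActions A / δ)))
    (fun w r => sum_sq_sub_le_two (strat_mem hA w r i) (pureStrat_mem a)) (by positivity) ?_
    (Real.sqrt_nonneg _)
  · refine key.trans (ENNReal.ofReal_le_ofReal ?_)
    rw [Real.sq_sqrt (by positivity)]
    have e1 : -2 * (T * Real.log (2 * maxActions A / δ)) / (2 * T)
        = -(1 * Real.log (2 * maxActions A / δ)) := by field_simp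
    rw [e1]
    refine (exp_neg_mul_log_le hQ1 le_rfl).trans_eq ?_
    push_cast; field_simp
  · rw [Finset.sum_Ico_eq_sum_range, add_tsub_cancel_left]
    have h1 : ∑ τ ∈ Finset.range T, 1 / (batch A L T Δ δ (L + τ) : ℝ)
        ≤ ∑ _τ ∈ Finset.range T, (1 : ℝ) := by
      refine Finset.sum_le_sum fun τ _ => ?_
      have : (1 : ℝ) ≤ batch A L T Δ δ (L + τ) := by exact_mod_cast hb1 τ
      rw [div_le_one (by linarith)]; exact this
    simp only [Finset.sum_const, Finset.card_range, nsmul_eq_mul, mul_one] at h1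
    linarith

/-- If all deviations are small, the output is a rationalizable approximate equilibrium. -/
theorem isNash_and_playsRationalizable (hA : ∀ i, 0 < A i) (hG : G.IsZeroSum) (hΔ : 0 < Δ)
    (hΔ1 : Δ ≤ 1) (hε : 0 < ε) (hε1 : ε ≤ 1) (hδ : 0 < δ) (hδ1 : δ < 1)
    (hTdef : T = numRounds (maxActions A) Δ ε δ) (hsel : IsArgmaxRule sel)
    (hy : IsDominating G Δ y) {w : ℕ → PlayerVec A} (hw : ∀ r i c, w r i c ∈ Set.Icc (0 : ℝ) 1)
    (h1 : ∀ l < G.elimLength Δ, ∀ i a, ∑ c, (pureStrat a c - y l i a c) * (w l i c -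
      G.devPayoff i (strat (G.elimLength Δ) Δ (ε / 2) sel a₀ w l) c) < Δ / 2)
    (h2 : ∀ t < T, 1 ≤ t → ∀ i a,
      ∑ τ ∈ Finset.Ico (G.elimLength Δ) (G.elimLength Δ + t),
      ∑ c, (pureStrat a c - y (G.elimLength Δ) i a c) *
      (w τ i c - G.devPayoff i (strat (G.elimLength Δ) Δ (ε / 2) sel a₀ w τ) c) < t * Δ / 4)
    (h3 : ∀ i a, ∑ τ ∈ Finset.Ico (G.elimLength Δ) (G.elimLength Δ + T),
      ∑ c, (strat (G.elimLength Δ) Δ (ε / 2) sel a₀ w τ i c - pureStrat a c) *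
      (w τ i c - G.devPayoff i (strat (G.elimLength Δ) Δ (ε / 2) sel a₀ w τ) c)
        < Real.sqrt (T * Real.log (2 * maxActions A / δ))) :
    G.IsNash ε (marginal (output (G.elimLength Δ) T Δ (ε / 2) sel a₀ w)) ∧
      G.PlaysRationalizable Δ (marginal (output (G.elimLength Δ) T Δ (ε / 2) sel a₀ w)) := by
  have hK := one_le_maxActions hA
  have hT1 : 1 ≤ T := hTdef ▸ one_le_numRounds hK hΔ hΔ1 hε hε1 hδ hδ1
  have hp0 := threshold_pos hA hΔ (half_pos hε)
  have hp1 := threshold_lt_one hA hΔ hΔ1 (half_pos hε)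
  have hAp := mul_threshold_le hA hΔ (half_pos hε)
  have hApΔ : ∀ i, A i * threshold A Δ (ε / 2) ≤ Δ / 16 := fun i =>
    (hAp i).trans (by linarith [min_le_right (ε / 2) Δ])
  have hApε : ∀ i, A i * threshold A Δ (ε / 2) ≤ ε / 32 := fun i =>
    (hAp i).trans (by linarith [min_le_left (ε / 2) Δ])
  have hAp1 : ∀ i, A i * threshold A Δ (ε / 2) < 1 := fun i => by linarith [hApΔ i]
  rw [marginal_output hA rfl hp0.le hAp1]
  set L := G.elimLength Δ with hL
  set θ := iterate L Δ (ε / 2) sel a₀ w with hθ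
  have hmem : ∀ t i, θ t i ∈ stdSimplex ℝ (Fin (A i)) := iterate_mem hA w
  constructor
  -- Each strategy has at most `ε/32` below the threshold, so clipping moves it by at most `ε/16`.
  -- The total error is `4ε/5 + ε/8 ≤ ε`.
  · have h := hG.isNash_average (x := θ)
      (x' := fun t i => clip (threshold A Δ (ε / 2)) (θ t i)) hmem
      (fun t i => clip_mem (hmem t i) hp0.le (hAp1 i)) hT1 (κ := 2 / 5 * ε) (μ := ε / 16)
      (fun i a => (sum_regret_le hΔ hA hT1 hp0 hp1 hw i a (h3 i a)).trans
        (regret_bound_le hA hΔ hΔ1 hε hε1 hδ hδ1 hTdef i))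
      (fun t i => (sum_abs_clip_sub_le (hmem t i) hp0.le (hAp1 i)).trans
        (by linarith [hApε i]))
    exact ⟨h.1, fun i a => le_trans (by linarith) (h.2 i a)⟩
  · intro i a ha hel
    have hbr := bestResponses_notMem_elim hsel hΔ hy h1 L le_rfl
    have hlt := iterate_lt_threshold hΔ hΔ1 hA hy (G.elimLength_spec Δ).2 hp0 hp1 hApΔ hbr h2
    refine ha ?_
    simp only
    rw [Finset.sum_eq_zero, zero_div]
    -- A clipped entry is nonzero only if the iterate reaches the threshold, which no eliminated
    -- action does in any round.
    intro t ht
    by_contra hne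
    exact absurd (le_of_clip_ne_zero hne) (not_le.2 (hlt t (Finset.mem_range.1 ht) i a hel))

theorem le_measure_isNash (hA : ∀ i, 0 < A i) (hG : G.IsZeroSum) (hΔ : 0 < Δ)
    (hΔ1 : Δ ≤ 1) (hε : 0 < ε) (hε1 : ε ≤ 1) (hδ : 0 < δ) (hδ1 : δ < 1)
    (hTdef : T = numRounds (maxActions A) Δ ε δ) (hsel : IsArgmaxRule sel)
    (hrun : IsRun G T Δ (ε / 2) δ sel a₀ P act fb) :
    ENNReal.ofReal (1 - 3 * δ) ≤ P {ω |
      let x := marginal (output (G.elimLength Δ) T Δ (ε / 2) sel a₀ (avgPayoff fb ω))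
      G.IsNash ε x ∧ G.PlaysRationalizable Δ x} := by
  have hT1 : 1 ≤ T := hTdef ▸ one_le_numRounds (one_le_maxActions hA) hΔ hΔ1 hε hε1 hδ hδ1
  obtain ⟨y, hy⟩ := exists_isDominating G Δ
  have b1 := measure_iUnion_actions_le (G.elimLength_spec Δ).1 hA hδ
    fun l hl i a => measure_bestResponse_deviation hA hΔ hδ hδ1 hsel hy hrun hl i a
  -- Index shift: the event with index `t` concerns the first `t + 1` Hedge rounds.
  have b2 := measure_iUnion_actions_le hT1 hA hδ
    fun t ht i a => measure_elimination_deviation hA hΔ hδ hδ1 hsel hy hrun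
      (Nat.le_add_left 1 t) (Nat.succ_le_of_lt ht) i a
  have b3 := measure_iUnion_actions_le le_rfl hA hδ
    fun _ _ i a => measure_regret_deviation hA hΔ hδ hδ1 hT1 hsel hrun i a
  set U₁ : Set Ω := ⋃ l ∈ Finset.range (G.elimLength Δ), _
  set U₂ : Set Ω := ⋃ t ∈ Finset.range T, _
  set U₃ : Set Ω := ⋃ l ∈ Finset.range 1, _
  set good : Set Ω := {ω |
      let x := marginal (output (G.elimLength Δ) T Δ (ε / 2) sel a₀ (avgPayoff fb ω))
      G.IsNash ε x ∧ G.PlaysRationalizable Δ x}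
  -- Subadditivity applied to a cover of the whole space needs no measurability of the good event.
  have hcover : Set.univ ⊆ good ∪ (U₁ ∪ U₂ ∪ U₃) := by
    intro ω _
    by_contra hω
    simp only [Set.mem_union, not_or] at hω
    obtain ⟨hgood, ⟨hU₁, hU₂⟩, hU₃⟩ := hω
    refine hgood (isNash_and_playsRationalizable hA hG hΔ hΔ1 hε hε1 hδ hδ1 hTdef hsel hy
      (avgPayoff_mem hrun.fb_mem ω) ?_ ?_ ?_)
    · intro l hl i a
      by_contra! hcon
      exact hU₁ (Set.mem_biUnion (Finset.mem_range.2 hl)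
        (Set.mem_iUnion.2 ⟨i, Set.mem_iUnion.2 ⟨a, hcon⟩⟩))
    · intro t ht ht1 i a
      by_contra! hcon
      obtain ⟨s, rfl⟩ : ∃ s, t = s + 1 := ⟨t - 1, by omega⟩
      exact hU₂ (Set.mem_biUnion (Finset.mem_range.2 (show s < T by omega))
        (Set.mem_iUnion.2 ⟨i, Set.mem_iUnion.2 ⟨a, hcon⟩⟩))
    · intro i a
      by_contra! hcon
      exact hU₃ (Set.mem_biUnion (Finset.mem_range.2 one_pos)
        (Set.mem_iUnion.2 ⟨i, Set.mem_iUnion.2 ⟨a, hcon⟩⟩))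
  have hbad : P (U₁ ∪ U₂ ∪ U₃) ≤ ENNReal.ofReal (3 * δ) := by
    refine ((measure_union_le _ _).trans (add_le_add ((measure_union_le _ _).trans
      (add_le_add b1 b2)) b3)).trans_eq ?_
    rw [← ENNReal.ofReal_add hδ.le hδ.le, ← ENNReal.ofReal_add (by linarith) hδ.le]
    congr 1; ring
  have htot : 1 ≤ P good + ENNReal.ofReal (3 * δ) := by
    rw [← measure_univ (μ := P)]
    exact ((measure_mono hcover).trans (measure_union_le _ _)).trans (by gcongr)
  rw [ENNReal.ofReal_sub _ (by linarith), ENNReal.ofReal_one]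
  exact tsub_le_iff_right.2 htot

end Run

end CCEHedge

theorem mainTheorem10 :
    ∃ (C : ℝ) (k : ℕ) (T : ℕ → ℝ → ℝ → ℝ → ℕ), 0 < C ∧
      (∀ (K : ℕ) (Δ ε δ : ℝ), 1 ≤ K → 0 < Δ → Δ ≤ 1 → 0 < ε → ε ≤ 1 → 0 < δ → δ < 1 →
        (T K Δ ε δ : ℝ) ≤
          C * (1 / ε ^ 2 + 1 / (ε * Δ)) * Real.log (2 * K / (Δ * ε * δ)) ^ k) ∧
      ∀ (A : Fin 2 → ℕ), (∀ i, 0 < A i) → ∀ (G : Game A), G.IsZeroSum →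
        ∀ (Δ ε δ : ℝ), 0 < Δ → Δ ≤ 1 → 0 < ε → ε ≤ 1 → 0 < δ → δ < 1 →
          (CCEHedge.numSamples G (T (maxActions A) Δ ε δ) Δ δ : ℝ) ≤
            C * (G.elimLength Δ * maxActions A / Δ ^ 2 + maxActions A / ε ^ 2) *
              Real.log (2 * maxActions A * G.elimLength Δ / (Δ * ε * δ)) ^ k ∧
          ∀ (sel : ∀ i, (Fin (A i) → ℝ) → Fin (A i)), IsArgmaxRule sel →
            ∀ (a₀ : Profile A) (Ω : Type*) [MeasurableSpace Ω] (P : Measure Ω)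
              [IsProbabilityMeasure P] (act) (fb),
              CCEHedge.IsRun G (T (maxActions A) Δ ε δ) Δ (ε / 2) δ sel a₀ P act fb →
              ENNReal.ofReal (1 - 3 * δ) ≤ P {ω |
                let x := marginal (CCEHedge.output (G.elimLength Δ) (T (maxActions A) Δ ε δ)
                  Δ (ε / 2) sel a₀ (avgPayoff fb ω))
                G.IsNash ε x ∧ G.PlaysRationalizable Δ x} := by
  refine ⟨50000, 2, CCEHedge.numRounds, by norm_num, ?_, ?_⟩
  · intro K Δ ε δ hK hΔ hΔ1 hε hε1 hδ hδ1
    refine (CCEHedge.numRounds_le hK hΔ hΔ1 hε hε1 hδ hδ1).trans ?_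
    exact mul_le_mul_of_nonneg_right
      (mul_le_mul_of_nonneg_right (by norm_num) (by positivity)) (sq_nonneg _)
  · intro A hA G hG Δ ε δ hΔ hΔ1 hε hε1 hδ hδ1
    refine ⟨CCEHedge.numSamples_le hA G hΔ hΔ1 hε hε1 hδ hδ1, ?_⟩
    intro sel hsel a₀ Ω _ P _ act fb hrun
    exact CCEHedge.le_measure_isNash hA hG hΔ hΔ1 hε hε1 hδ hδ1 rfl hsel hrun
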